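/- Throughout, $N\ge 1$, $\mathbb B_N$ and $\mathbb S_N$ are the open unit ball and the unit sphere of $\mathbb C^N$, and an Orlicz function is a strictly convex $\psi:[0,\infty)\to[0,\infty)$ with $\psi(0)=0$, continuous at $0$, with $\psi(x)/x\to\infty$ as $x\to\infty$. For $\alpha>-1$, $v_\alpha$ is the probability measure on $\mathbb B_N$ proportional to $(1-|z|^2)^\alpha\,dv$ ($v$ being Lebesgue measure), and $v_{-1}=\sigma_N$ is the normalized rotation-invariant measure on $\mathbb S_N$. $L^\psi_\alpha$ (resp. $M^\psi_\alpha$) is the space of measurable $f$ such that $\int\psi(|f|/C)\,dv_\alpha<\infty$ for some (resp. every) $C>0$, and $\|f\|_\psi=\inf\{C>0:\int\psi(|f|/C)\,dv_\alpha\le1\}$ is the Luxemburg norm. For $\alpha>-1$, $A^\psi_\alpha$ is the space of holomorphic functions on $\mathbb B_N$ that belong to $L^\psi_\alpha$, with this norm; $A^\psi_{-1}$ is the Hardy-Orlicz space of holomorphic $f$ with $\|f\|:=\sup_{0<r<1}\|f(r\,\cdot)\|_{\psi}<\infty$, the norms being taken in $L^\psi(\mathbb S_N,\sigma_N)$. For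 $\phi:\mathbb B_N\to\mathbb B_N$ holomorphic let $C_\phi f=f\circ\phi$. For $g$ defined on $\mathbb B_N$ put $g^*=g$ if $\alpha>-1$, and let $g^*$ be the radial limit of $g$ on $\mathbb S_N$ if $\alpha=-1$. For $Z=L^\psi_\alpha$ or $Z=M^\psi_\alpha$, we say that $C_\phi$ acting on $A^\psi_\alpha$ is order bounded into $Z$ if $C_\phi$ maps $A^\psi_\alpha$ into itself and there is $y\in Z$, $y\ge0$, such that for every $f$ in the closed unit ball of $A^\psi_\alpha$, $(f\circ\phi)^*$ exists and $|(f\circ\phi)^*|\le y$ $v_\alpha$-almost everywhere. Let $\mu_\phi(E)=v_\alpha((\phi^*)^{-1}(E))$ and, for $0<h<1$, $C_\alpha(h)=\{z\in\mathbb B_N:1-|z|<h\}$ if $\alpha>-1$, $C_{-1}(h)=\{z\in\overline{\mathbb B_N}:1-|z|<h\}$. **Theorem.** Let $\alpha\ge-1$, let $\psi$ be an Orlicz function and let $\phi:\mathbb B_N\to\mathbb B_N$ be holomorphic. 1. (a) If $C_\phi$ acting on $A^\psi_\alpha$ is order bounded into $L^\psi_\alpha$, then there exist $A>0$ and $\eta\in(0,1)$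 such that $$\mu_\phi(C_\alpha(h))\le\frac{1}{\psi\bigl(A\psi^{-1}(1/h^{N+\alpha+1})\bigr)}\quad\text{for all }h\in(0,\eta).\qquad(\mathrm{I})$$ (b) If $\psi$ satisfies the $\Delta^1$-condition (there is $C>0$ with $x\psi(x)\le\psi(Cx)$ for all large $x$), then the existence of $A>0$ and $\eta\in(0,1)$ with (I) is sufficient for $C_\phi$ to be order bounded into $L^\psi_\alpha$. 2. (a) If $C_\phi$ acting on $A^\psi_\alpha$ is order bounded into $M^\psi_\alpha$, then for every $A>0$ there exist $C_A>0$ and $h_A\in(0,1)$ such that $$\mu_\phi(C_\alpha(h))\le\frac{C_A}{\psi\bigl(A\psi^{-1}(1/h^{N+\alpha+1})\bigr)}\quad\text{for all }h\in(0,h_A).\qquad(\mathrm{II})$$ (b) If $\psi$ satisfies the $\Delta^1$-condition, then the existence, for every $A>0$, of $C_A>0$ and $h_A\in(0,1)$ with (II) is sufficient for $C_\phi$ to be order bounded into $M^\psi_\alpha$. -/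

import Mathlib

open MeasureTheory Set Filter Topology
open scoped ENNReal

namespace BergmanOrlicz

/-! ### Orlicz functions and Orlicz spaces -/

/-- An Orlicz function `ψ : [0, ∞) → [0, ∞)`; only the values on `[0, ∞)` matter. -/
structure IsOrlicz (ψ : ℝ → ℝ) : Prop where
  nonneg : ∀ x, 0 ≤ x → 0 ≤ ψ x
  strictConvexOn : StrictConvexOn ℝ (Ici 0) ψ
  map_zero : ψ 0 = 0
  continuous_zero : ContinuousWithinAt ψ (Ici 0) 0
  tendsto_div : Tendsto (fun x => ψ x / x) atTop atTop

/-- The inverse of the bijection `ψ : [0, ∞) → [0, ∞)`. -/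
noncomputable def orliczInv (ψ : ℝ → ℝ) : ℝ → ℝ :=
  Function.invFunOn ψ (Ici 0)

/-- The `Δ¹`-condition: `x ψ(x) ≤ ψ(C x)` for all large `x`. -/
def DeltaUpOne (ψ : ℝ → ℝ) : Prop :=
  ∃ C : ℝ, 0 < C ∧ ∀ᶠ x : ℝ in atTop, x * ψ x ≤ ψ (C * x)

section Orlicz

variable {Ω F : Type*} [MeasurableSpace Ω] [NormedAddCommGroup F]

/-- The modular `∫ ψ(|f| / C) dμ`, with values in `[0, ∞]`. -/
noncomputable def modular (ψ : ℝ → ℝ) (μ : Measure Ω) (f : Ω → F) (C : ℝ) : ℝ≥0∞ :=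
  ∫⁻ x, ENNReal.ofReal (ψ (‖f x‖ / C)) ∂μ

/-- `f` belongs to the Orlicz space `L^ψ(μ)`. -/
def MemOrlicz (ψ : ℝ → ℝ) (μ : Measure Ω) (f : Ω → F) : Prop :=
  AEStronglyMeasurable f μ ∧ ∃ C : ℝ, 0 < C ∧ modular ψ μ f C < ∞

/-- `f` belongs to the Morse-Transue space `M^ψ(μ)`. -/
def MemMorseTransue (ψ : ℝ → ℝ) (μ : Measure Ω) (f : Ω → F) : Prop :=
  AEStronglyMeasurable f μ ∧ ∀ C : ℝ, 0 < C → modular ψ μ f C < ∞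

/-- The Luxemburg norm of `f`, with values in `[0, ∞]`; it is `∞` if there is no admissible
constant. -/
noncomputable def luxemburgNorm (ψ : ℝ → ℝ) (μ : Measure Ω) (f : Ω → F) : ℝ≥0∞ :=
  ⨅ (C : ℝ) (_ : 0 < C) (_ : modular ψ μ f C ≤ 1), ENNReal.ofReal C

end Orlicz

/-! ### The ball and the sphere of `ℂ^N`, and their measures -/

/-- `ℂ^N` with its Euclidean norm. -/
abbrev Cn (N : ℕ) : Type := EuclideanSpace ℂ (Fin N)

/-- The open unit ball of `ℂ^N`. -/
def unitBall (N : ℕ) : Set (Cn N) := Metric.ball 0 1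

/-- Lebesgue measure on the ball with density `(1 - |z|²)^α`, not normalized. -/
noncomputable def weightedBallMeasure (N : ℕ) (α : ℝ) : Measure (Cn N) :=
  ((volume : Measure (Cn N)).restrict (unitBall N)).withDensity
    (fun z => ENNReal.ofReal ((1 - ‖z‖ ^ 2) ^ α))

/-- The surface measure of the unit sphere, as a measure on `ℂ^N`, not normalized. -/
noncomputable def surfaceMeasure (N : ℕ) : Measure (Cn N) :=
  ((volume : Measure (Cn N)).toSphere).map Subtype.val

open Classical in
/-- The probability measure `v_α`: the normalized weighted Lebesgue measure on the ball if
`α > -1`, and the normalized rotation-invariant measure `σ_N` on the sphere if `α = -1`. -/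
noncomputable def vMeasure (N : ℕ) (α : ℝ) : Measure (Cn N) :=
  if α = -1 then (surfaceMeasure N univ)⁻¹ • surfaceMeasure N
  else (weightedBallMeasure N α univ)⁻¹ • weightedBallMeasure N α

/-! ### Bergman-Orlicz and Hardy-Orlicz spaces -/

open Classical in
/-- The norm of `A_α^ψ`: the Luxemburg norm in `L^ψ(v_α)` if `α > -1`, and
`sup_{0 < r < 1} ‖f_r‖_ψ` in `L^ψ(σ_N)` (the Hardy-Orlicz norm) if `α = -1`. -/
noncomputable def spaceNorm (N : ℕ) (α : ℝ) (ψ : ℝ → ℝ) (f : Cn N → ℂ) : ℝ≥0∞ :=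
  if α = -1 then
    ⨆ r ∈ Ioo (0 : ℝ) 1, luxemburgNorm ψ (vMeasure N (-1)) (fun ζ : Cn N => f (r • ζ))
  else luxemburgNorm ψ (vMeasure N α) f

/-- `A_α^ψ(𝔹_N)`: the Bergman-Orlicz space if `α > -1`, the Hardy-Orlicz space if `α = -1`.
Only the values of `f` on the ball matter. -/
def MemSpace (N : ℕ) (α : ℝ) (ψ : ℝ → ℝ) (f : Cn N → ℂ) : Prop :=
  DifferentiableOn ℂ f (unitBall N) ∧ spaceNorm N α ψ f < ∞

/-! ### Composition operators -/

open Classical in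
/-- `g`, a map on the ball, takes the value `w` at `z`: the actual value if `α > -1`,
the radial limit `g*(z)` at a point `z` of the sphere if `α = -1`. -/
def HasValue {N : ℕ} {F : Type*} [TopologicalSpace F] (α : ℝ) (g : Cn N → F) (z : Cn N) (w : F) :
    Prop :=
  if α = -1 then Tendsto (fun r : ℝ => g (r • z)) (𝓝[<] 1) (𝓝 w) else g z = w

/-- The composition operator `C_φ` acts on `A_α^ψ` and, viewed as an operator from `A_α^ψ` to
`L^ψ(v_α)`, is order bounded into the space of all `y` with `Z y`. -/
def OrderBoundedInto (N : ℕ) (α : ℝ) (ψ : ℝ → ℝ) (φ : Cn N → Cn N)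
    (Z : (Cn N → ℝ) → Prop) : Prop :=
  (∀ f : Cn N → ℂ, MemSpace N α ψ f → MemSpace N α ψ (f ∘ φ)) ∧
  ∃ y : Cn N → ℝ, Z y ∧ (∀ᵐ z ∂(vMeasure N α), 0 ≤ y z) ∧
    ∀ f : Cn N → ℂ, MemSpace N α ψ f → spaceNorm N α ψ f ≤ 1 →
      ∀ᵐ z ∂(vMeasure N α), ∃ w : ℂ, HasValue α (f ∘ φ) z w ∧ ‖w‖ ≤ y z

/-- The pull-back measure `μ_{φ,α}(E) = v_α(φ⁻¹(E))`, resp. `σ_N((φ*)⁻¹(E))` if `α = -1`. -/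
noncomputable def pullback (N : ℕ) (α : ℝ) (φ : Cn N → Cn N) (E : Set (Cn N)) : ℝ≥0∞ :=
  vMeasure N α {z | ∃ w ∈ E, HasValue α φ z w}

open Classical in
/-- The corona `C_α(h)`; it contains the sphere if `α = -1`. -/
def corona (N : ℕ) (α h : ℝ) : Set (Cn N) :=
  if α = -1 then {z | z ∈ Metric.closedBall (0 : Cn N) 1 ∧ 1 - ‖z‖ < h}
  else {z | z ∈ unitBall N ∧ 1 - ‖z‖ < h}

/-- The function `1 / ψ(A ψ⁻¹(1 / h^{N + α + 1}))` of `h`. -/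
noncomputable def decay (N : ℕ) (α : ℝ) (ψ : ℝ → ℝ) (A h : ℝ) : ℝ :=
  1 / ψ (A * orliczInv ψ (1 / h ^ ((N : ℝ) + α + 1)))

end BergmanOrlicz

open BergmanOrlicz

namespace BergmanOrlicz

/-! ### Elementary properties of Orlicz functions -/

namespace IsOrlicz

variable {ψ : ℝ → ℝ} (hψ : IsOrlicz ψ)
include hψ

/-! Write `p = N + α + 1`. Everything rests on the growth `ψ⁻¹(1/(1-|a|)^p)` at a point `a`: up to
constant factors it is the largest value that functions in the unit ball of the space can take at
`a`.

Upper bound (`exists_norm_point_le`). `ψ(|f|/K)` satisfies a submean value inequality over a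
nonisotropic polydisc about `a`, of radius about `s = 1-|a|` in the direction of `a` and about `√s`
in the others. Its volume is of order `s^(N+1)`, and it lies in a shell over which the integral is
at most of order `s^(-α)`. Division gives `s^(-p)`.

Lower bound (`exists_unitModular_testKernel`). The functions `c ψ⁻¹(1/δ^p) (δ/(1+δ-⟨z,ξ⟩))^k` lie in
the unit ball. By convexity it is enough that the kernel has `L¹` norm of order `δ^p`, which follows
from the estimate `v_α(cap of size t) ≲ t^p`.

Necessity. A majorant `y` dominates all test functions composed with `φ`, hence `y ≥ c ψ⁻¹(1/h^p)`
wherever `φ*` lies in the corona of width `h`. Markov's inequality for the modular then bounds the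
measure of that set.

Sufficiency. The natural majorant is a multiple of `ψ⁻¹(1/(1-|φ*|)^p)`. With `h^p = 1/ψ(t)` the
corona estimate becomes the tail bound `D/ψ(At)` for this function. Under `Δ¹`, `ψ(At/C₀)/ψ(At) ≤
C₀/(At)`, which is summable over dyadic `t`, so the majorant has finite modular
(`lintegral_lt_top_of_deltaUpOne`).

The Hardy case also needs radial limits. Fatou's theorem is proved on the disc and carried to slices
by rotation invariance. That `C_φ` preserves the space follows by bounding the modulars on spheres
of radius `r < 1` by the modular of the boundary majorant. -/

theorem map_mul_le {t x : ℝ} (ht0 : 0 ≤ t) (ht1 : t ≤ 1) (hx : 0 ≤ x) :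
    ψ (t * x) ≤ t * ψ x := by
  have h := hψ.strictConvexOn.convexOn.2 (mem_Ici.2 hx) (mem_Ici.2 le_rfl) ht0
    (sub_nonneg.2 ht1) (by ring)
  simpa [hψ.map_zero] using h

theorem map_div_le {t x : ℝ} (ht : 1 ≤ t) (hx : 0 ≤ x) : ψ (x / t) ≤ ψ x / t := by
  have h := hψ.map_mul_le (t := t⁻¹) (by positivity) (inv_le_one_of_one_le₀ ht) hx
  rwa [inv_mul_eq_div, inv_mul_eq_div] at h

theorem pos {x : ℝ} (hx : 0 < x) : 0 < ψ x := by
  have h := hψ.strictConvexOn.2 (mem_Ici.2 hx.le) (mem_Ici.2 le_rfl) hx.ne'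
    (show (0 : ℝ) < 1 / 2 by norm_num) (show (0 : ℝ) < 1 / 2 by norm_num) (by norm_num)
  have h0 := hψ.nonneg ((1 / 2 : ℝ) • x + (1 / 2 : ℝ) • 0) (by simp; positivity)
  simp only [hψ.map_zero, smul_eq_mul, mul_zero, add_zero] at h h0
  linarith

theorem strictMonoOn : StrictMonoOn ψ (Ici 0) := by
  intro x hx y hy hxy
  have hy0 : 0 < y := lt_of_le_of_lt hx hxy
  have h := hψ.map_mul_le (t := x / y) (div_nonneg hx hy) (div_le_one_of_le₀ hxy.le hy) hy
  rw [div_mul_cancel₀ _ hy0.ne'] at h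
  refine h.trans_lt ?_
  have := hψ.pos hy0
  have h1 : x / y < 1 := (div_lt_one hy0).2 hxy
  nlinarith

theorem monotoneOn : MonotoneOn ψ (Ici 0) := hψ.strictMonoOn.monotoneOn

theorem mono {x y : ℝ} (hx : 0 ≤ x) (hxy : x ≤ y) : ψ x ≤ ψ y :=
  hψ.monotoneOn hx (mem_Ici.2 (hx.trans hxy)) hxy

theorem continuousOn : ContinuousOn ψ (Ici 0) := by
  intro x hx
  rcases (mem_Ici.1 hx).eq_or_lt with rfl | hx0
  · exact hψ.continuous_zero
  · have h := hψ.strictConvexOn.convexOn.continuousOn_interior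
    rw [interior_Ici] at h
    exact (h.continuousAt (Ioi_mem_nhds hx0)).continuousWithinAt

theorem continuous_max : Continuous (fun x => ψ (max x 0)) :=
  hψ.continuousOn.comp_continuous (by fun_prop) (fun x => le_max_right x 0)

theorem continuous_comp {X : Type*} [TopologicalSpace X] {u : X → ℝ} (hu : Continuous u)
    (h0 : ∀ x, 0 ≤ u x) : Continuous fun x => ψ (u x) :=
  hψ.continuousOn.comp_continuous hu h0

theorem aemeasurable_comp {Ω : Type*} [MeasurableSpace Ω] {μ : Measure Ω} {u : Ω → ℝ}
    (hu : AEMeasurable u μ) (h0 : ∀ x, 0 ≤ u x) :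
    AEMeasurable (fun x => ENNReal.ofReal (ψ (u x))) μ := by
  have : (fun x => ENNReal.ofReal (ψ (u x))) = fun x => ENNReal.ofReal (ψ (max (u x) 0)) := by
    ext x; rw [max_eq_left (h0 x)]
  rw [this]
  exact (hψ.continuous_max.measurable.comp_aemeasurable hu).ennreal_ofReal

theorem tendsto_atTop : Tendsto ψ atTop atTop := by
  refine tendsto_atTop_mono' atTop ?_ tendsto_id
  filter_upwards [hψ.tendsto_div.eventually_ge_atTop 1, eventually_gt_atTop 0] with x h1 hx
  rwa [le_div_iff₀ hx, one_mul] at h1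

theorem surjOn : SurjOn ψ (Ici 0) (Ici 0) := by
  intro y hy
  obtain ⟨b, hb0, hb⟩ := ((eventually_ge_atTop 0).and
    (hψ.tendsto_atTop.eventually_ge_atTop y)).exists
  obtain ⟨x, hx, rfl⟩ := intermediate_value_Icc hb0 (hψ.continuousOn.mono Icc_subset_Ici_self)
    ⟨by rw [hψ.map_zero]; exact hy, hb⟩
  exact ⟨x, hx.1, rfl⟩

theorem inv_nonneg {y : ℝ} (hy : 0 ≤ y) : 0 ≤ orliczInv ψ y :=
  Function.invFunOn_mem (hψ.surjOn hy)

theorem map_inv {y : ℝ} (hy : 0 ≤ y) : ψ (orliczInv ψ y) = y :=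
  Function.invFunOn_eq (hψ.surjOn hy)

theorem le_inv_iff {x y : ℝ} (hx : 0 ≤ x) (hy : 0 ≤ y) : x ≤ orliczInv ψ y ↔ ψ x ≤ y := by
  rw [← hψ.strictMonoOn.le_iff_le hx (hψ.inv_nonneg hy), hψ.map_inv hy]

theorem inv_le_iff {x y : ℝ} (hx : 0 ≤ x) (hy : 0 ≤ y) : orliczInv ψ y ≤ x ↔ y ≤ ψ x := by
  rw [← hψ.strictMonoOn.le_iff_le (hψ.inv_nonneg hy) hx, hψ.map_inv hy]

theorem lt_inv_iff {x y : ℝ} (hx : 0 ≤ x) (hy : 0 ≤ y) : x < orliczInv ψ y ↔ ψ x < y := by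
  rw [← not_le, ← not_le, hψ.inv_le_iff hx hy]

theorem inv_map {x : ℝ} (hx : 0 ≤ x) : orliczInv ψ (ψ x) = x :=
  le_antisymm ((hψ.inv_le_iff hx (hψ.nonneg x hx)).2 le_rfl)
    ((hψ.le_inv_iff hx (hψ.nonneg x hx)).2 le_rfl)

theorem inv_mono {x y : ℝ} (hx : 0 ≤ x) (hxy : x ≤ y) : orliczInv ψ x ≤ orliczInv ψ y := by
  rw [hψ.le_inv_iff (hψ.inv_nonneg hx) (hx.trans hxy), hψ.map_inv hx]; exact hxy

theorem inv_pos {y : ℝ} (hy : 0 < y) : 0 < orliczInv ψ y := by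
  rw [hψ.lt_inv_iff le_rfl hy.le, hψ.map_zero]; exact hy

/-- This is the concavity of `ψ⁻¹`, read off from `ψ(x/K) ≤ ψ(x)/K`. It turns multiplicative
constants inside `ψ⁻¹` into constants outside. -/
theorem inv_mul_le {K y : ℝ} (hK : 1 ≤ K) (hy : 0 ≤ y) :
    orliczInv ψ (K * y) ≤ K * orliczInv ψ y := by
  have hK0 : 0 < K := by linarith
  have h0 := hψ.inv_nonneg hy
  rw [hψ.inv_le_iff (by positivity) (by positivity)]
  have h := hψ.map_div_le hK (x := K * orliczInv ψ y) (by positivity)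
  rw [mul_div_cancel_left₀ _ hK0.ne', hψ.map_inv hy, le_div_iff₀ hK0] at h
  linarith

/-- `orliczInv` carries no information at negative arguments; truncating at `0` gives a function
monotone on the whole line. -/
theorem measurable_inv_max : Measurable (fun x => orliczInv ψ (max x 0)) := by
  refine Monotone.measurable fun x y hxy => hψ.inv_mono (le_max_right _ _) ?_
  exact max_le_max_right 0 hxy

end IsOrlicz

/-! ### The modular and the Luxemburg norm -/

section Luxemburg

variable {Ω F : Type*} [MeasurableSpace Ω] [NormedAddCommGroup F] {ψ : ℝ → ℝ} {μ : Measure Ω}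

theorem modular_anti (hψ : IsOrlicz ψ) {f : Ω → F} {C D : ℝ} (hC : 0 < C) (hCD : C ≤ D) :
    modular ψ μ f D ≤ modular ψ μ f C := by
  refine lintegral_mono fun x => ENNReal.ofReal_le_ofReal (hψ.mono ?_ ?_)
  · have : 0 < D := hC.trans_le hCD
    positivity
  · gcongr

theorem modular_mono_ae (hψ : IsOrlicz ψ) {F' : Type*} [NormedAddCommGroup F'] {f : Ω → F}
    {g : Ω → F'} {C : ℝ} (hC : 0 < C) (h : ∀ᵐ x ∂μ, ‖f x‖ ≤ ‖g x‖) :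
    modular ψ μ f C ≤ modular ψ μ g C := by
  refine lintegral_mono_ae ?_
  filter_upwards [h] with x hx
  exact ENNReal.ofReal_le_ofReal (hψ.mono (by positivity) (by gcongr))

theorem modular_mul_le (hψ : IsOrlicz ψ) {f : Ω → F} {C t : ℝ} (hC : 0 < C) (ht : 1 ≤ t) :
    modular ψ μ f (C * t) ≤ ENNReal.ofReal t⁻¹ * modular ψ μ f C := by
  have ht0 : 0 < t := by linarith
  rw [modular, modular, ← lintegral_const_mul' _ _ ENNReal.ofReal_ne_top]
  refine lintegral_mono fun x => ?_
  rw [← ENNReal.ofReal_mul (by positivity)]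
  refine ENNReal.ofReal_le_ofReal ?_
  have := hψ.map_div_le ht (x := ‖f x‖ / C) (by positivity)
  rwa [div_div, ← inv_mul_eq_div t] at this

/-- By convexity, enlarging the constant by a factor `t ≥ 1` divides the modular by at least `t`;
the factor `m + 1` suffices for a modular equal to `m`. -/
theorem exists_modular_le_one (hψ : IsOrlicz ψ) {f : Ω → F} {C : ℝ} (hC : 0 < C)
    (h : modular ψ μ f C < ∞) : ∃ D, C ≤ D ∧ modular ψ μ f D ≤ 1 := by
  set m := (modular ψ μ f C).toReal with hm
  have hm0 : 0 ≤ m := ENNReal.toReal_nonneg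
  refine ⟨C * (m + 1), by nlinarith, (modular_mul_le hψ hC (by linarith)).trans ?_⟩
  rw [← ENNReal.ofReal_toReal h.ne, ← hm, ← ENNReal.ofReal_mul (by positivity),
    ENNReal.ofReal_le_one, inv_mul_le_iff₀ (by linarith)]
  linarith

theorem luxemburgNorm_le {f : Ω → F} {C : ℝ} (hC : 0 < C) (h : modular ψ μ f C ≤ 1) :
    luxemburgNorm ψ μ f ≤ ENNReal.ofReal C :=
  iInf_le_of_le C (iInf_le_of_le hC (iInf_le_of_le h le_rfl))

theorem modular_le_one_of_luxemburgNorm_lt (hψ : IsOrlicz ψ) {f : Ω → F} {C : ℝ}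
    (h : luxemburgNorm ψ μ f < ENNReal.ofReal C) : modular ψ μ f C ≤ 1 := by
  simp only [luxemburgNorm, iInf_lt_iff] at h
  obtain ⟨D, hD, h1, hDC⟩ := h
  exact (modular_anti hψ hD (ENNReal.ofReal_lt_ofReal_iff_of_nonneg hD.le |>.1 hDC).le).trans h1

/-- Markov's inequality for the modular. -/
theorem measure_le_norm_le_modular (hψ : IsOrlicz ψ) {f : Ω → F} (hf : AEStronglyMeasurable f μ)
    {C s : ℝ} (hC : 0 < C) (hs : 0 < s) :
    μ {x | s ≤ ‖f x‖} ≤ modular ψ μ f C * ENNReal.ofReal (1 / ψ (s / C)) := by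
  have h0 : 0 < ψ (s / C) := hψ.pos (by positivity)
  have h := mul_meas_ge_le_lintegral₀
    (hψ.aemeasurable_comp (hf.norm.aemeasurable.div_const C) (fun x => by positivity))
    (ENNReal.ofReal (ψ (s / C)))
  rw [one_div, ENNReal.ofReal_inv_of_pos h0, ← div_eq_mul_inv, ENNReal.le_div_iff_mul_le
    (Or.inl (by simpa using h0)) (Or.inl ENNReal.ofReal_ne_top), mul_comm]
  refine le_trans ?_ h
  gcongr
  exact fun hx => ENNReal.ofReal_le_ofReal (hψ.mono (by positivity) (by gcongr))

end Luxemburg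

end BergmanOrlicz

namespace BergmanOrlicz

/-! ### Poisson representation and Jensen's inequality on the disc -/

/-- The measure is the Poisson kernel times `dθ/2π`. It depends on `w` and `R` but not on `f`, so
the same `ν` serves all slices of a function of several variables and can be exchanged with another
integral. -/
theorem exists_poisson_measure {R : ℝ} {w : ℂ} (hw : w ∈ Metric.ball (0 : ℂ) R) :
    ∃ ν : Measure ℝ, IsProbabilityMeasure ν ∧ ∀ f : ℂ → ℂ, DiffContOnCl ℂ f (Metric.ball 0 R) →
      f w = ∫ θ, f (circleMap 0 R θ) ∂ν := by
  have hR : 0 < R := (norm_nonneg _).trans_lt (mem_ball_zero_iff.1 hw)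
  have hwR : ‖w‖ < R := mem_ball_zero_iff.1 hw
  set k : ℝ → ℝ := fun θ => (2 * Real.pi)⁻¹ * poissonKernel 0 w (circleMap 0 R θ) with hk
  have hne : ∀ θ, circleMap 0 R θ - w ≠ 0 := fun θ h => by
    have : ‖circleMap 0 R θ‖ = ‖w‖ := by rw [sub_eq_zero.1 h]
    rw [norm_circleMap_zero, abs_of_pos hR] at this
    linarith
  have hkc : Continuous k := by
    simp only [hk, poissonKernel_def, sub_zero]
    refine continuous_const.mul (Continuous.div (by fun_prop) (by fun_prop) fun θ => ?_)
    exact pow_ne_zero _ (norm_ne_zero_iff.2 (hne θ))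
  have hk0 : ∀ θ, 0 ≤ k θ := fun θ => by
    simp only [hk, poissonKernel_def, sub_zero, norm_circleMap_zero, abs_of_pos hR]
    have : 0 ≤ R ^ 2 - ‖w‖ ^ 2 := by nlinarith [norm_nonneg w]
    positivity
  set ν : Measure ℝ := (volume.restrict (Ioc 0 (2 * Real.pi))).withDensity
    (fun θ => ENNReal.ofReal (k θ)) with hν
  have hrep : ∀ f : ℂ → ℂ, DiffContOnCl ℂ f (Metric.ball 0 R) →
      f w = ∫ θ, f (circleMap 0 R θ) ∂ν := fun f hf => by
    rw [hν, integral_withDensity_eq_integral_toReal_smul (by fun_prop) (by simp),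
      ← hf.circleAverage_poissonKernel_smul hw, Real.circleAverage_def,
      intervalIntegral.integral_of_le (by positivity), ← integral_smul]
    refine integral_congr_ae (Eventually.of_forall fun θ => ?_)
    simp only [Pi.smul_apply', ENNReal.toReal_ofReal (hk0 θ)]
    simp only [hk, mul_smul]
  have hint : Integrable k (volume.restrict (Ioc 0 (2 * Real.pi))) :=
    (hkc.integrableOn_Icc (a := 0) (b := 2 * Real.pi)).mono_set Ioc_subset_Icc_self
  refine ⟨ν, ⟨?_⟩, hrep⟩
  -- The total mass comes from the representation of the constant function `1`.
  have h1 := hrep (fun _ => 1) diffContOnCl_const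
  have : IsFiniteMeasure ν := isFiniteMeasure_withDensity_ofReal hint.2
  rw [integral_const] at h1
  have h2 : ν.real univ = 1 := by
    have := congrArg Complex.re h1
    simpa using this.symm
  rwa [measureReal_def, ENNReal.toReal_eq_one_iff] at h2

/-- Jensen's inequality for the Poisson measure: this is the subharmonicity of `ψ(|f|/K)`, in the
only form used below. -/
theorem exists_poisson_jensen {ψ : ℝ → ℝ} (hψ : IsOrlicz ψ) {R : ℝ} {w : ℂ}
    (hw : w ∈ Metric.ball (0 : ℂ) R) :
    ∃ ν : Measure ℝ, IsProbabilityMeasure ν ∧ ∀ f : ℂ → ℂ, DiffContOnCl ℂ f (Metric.ball 0 R) →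
      ∀ K : ℝ, 0 < K → ENNReal.ofReal (ψ (‖f w‖ / K)) ≤
        ∫⁻ θ, ENNReal.ofReal (ψ (‖f (circleMap 0 R θ)‖ / K)) ∂ν := by
  have hR : 0 < R := (norm_nonneg _).trans_lt (mem_ball_zero_iff.1 hw)
  obtain ⟨ν, hν, hrep⟩ := exists_poisson_measure hw
  refine ⟨ν, hν, fun f hf K hK => ?_⟩
  have hmem : ∀ θ, circleMap 0 R θ ∈ closure (Metric.ball (0 : ℂ) R) := fun θ => by
    rw [closure_ball _ hR.ne']
    exact circleMap_mem_closedBall 0 hR.le θ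
  have hc : Continuous fun θ => f (circleMap 0 R θ) :=
    hf.2.comp_continuous (continuous_circleMap 0 R) hmem
  obtain ⟨M, hM⟩ := (isCompact_closedBall (0 : ℂ) R).exists_bound_of_continuousOn
    (by rw [← closure_ball _ hR.ne']; exact hf.2)
  have hM' : ∀ θ, ‖f (circleMap 0 R θ)‖ ≤ M := fun θ =>
    hM _ (circleMap_mem_closedBall 0 hR.le θ)
  have hψc : Continuous fun θ => ψ (‖f (circleMap 0 R θ)‖ / K) :=
    hψ.continuous_comp (hc.norm.div_const K) (fun θ => by positivity)
  have hi1 : Integrable (fun θ => ‖f (circleMap 0 R θ)‖ / K) ν := by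
    refine Integrable.of_bound (hc.norm.div_const K).aestronglyMeasurable (M / K) (Eventually.of_forall fun θ => ?_)
    rw [Real.norm_of_nonneg (by positivity)]
    gcongr
    exact hM' θ
  have hi2 : Integrable (fun θ => ψ (‖f (circleMap 0 R θ)‖ / K)) ν := by
    refine Integrable.of_bound hψc.aestronglyMeasurable (ψ (M / K))
      (Eventually.of_forall fun θ => ?_)
    rw [Real.norm_of_nonneg (hψ.nonneg _ (by positivity))]
    exact hψ.mono (by positivity) (by gcongr; exact hM' θ)
  rw [← ofReal_integral_eq_lintegral_ofReal hi2
    (Eventually.of_forall fun θ => hψ.nonneg _ (by positivity))]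
  refine ENNReal.ofReal_le_ofReal ?_
  refine le_trans (hψ.mono (by positivity) ?_) (hψ.strictConvexOn.convexOn.map_integral_le
    hψ.continuousOn isClosed_Ici (Eventually.of_forall fun θ => ?_) hi1 hi2)
  · rw [hrep f hf, integral_div]
    gcongr
    exact norm_integral_le_integral_norm _
  · exact mem_Ici.2 (by positivity)

/-! ### Radial limits of bounded holomorphic functions -/

/-- If a Lipschitz holomorphic function on the disc is `o(|w - 1|)` on the circle, then it is
`o(|w - 1|)` in the disc. -/
theorem littleO_at_one_of_circle {R : ℂ → ℂ} (hR : DiffContOnCl ℂ R (Metric.ball 0 1)) {K : ℝ}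
    (hK : ∀ w ∈ Metric.closedBall (0 : ℂ) 1, ‖R w‖ ≤ K * ‖w - 1‖)
    (hcirc : ∀ ε > 0, ∃ δ > 0, ∀ w : ℂ, ‖w‖ = 1 → ‖w - 1‖ < δ → ‖R w‖ ≤ ε * ‖w - 1‖)
    {ε : ℝ} (hε : 0 < ε) :
    ∃ δ > 0, ∀ w ∈ Metric.closedBall (0 : ℂ) 1, ‖w - 1‖ < δ → ‖R w‖ ≤ ε * ‖w - 1‖ := by
  obtain ⟨δ₀, hδ₀, hc⟩ := hcirc (ε / 2) (by positivity)
  have hre : ∀ w ∈ Metric.closedBall (0 : ℂ) 1, w.re ≤ 1 := fun w hw =>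
    (Complex.re_le_norm w).trans (mem_closedBall_zero_iff.1 hw)
  -- The factor `exp(n(w-1))` damps `R` away from `1`. On the circle `Re w - 1 = -|w-1|²/2`, so for
  -- `|w-1| ≥ δ₀` it is at most `exp(-nδ₀²/2)`, which compensates the Lipschitz constant.
  obtain ⟨n, hn1, hn⟩ : ∃ n : ℝ, 0 < n ∧ |K| * Real.exp (-(n * (δ₀ ^ 2 / 2))) ≤ ε / 2 := by
    have h1 : Tendsto (fun n : ℝ => |K| * Real.exp (-(n * (δ₀ ^ 2 / 2)))) atTop
        (𝓝 (|K| * 0)) :=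
      ((Real.tendsto_exp_neg_atTop_nhds_zero.comp
        (tendsto_id.atTop_mul_const (by positivity)))).const_mul _
    rw [mul_zero] at h1
    obtain ⟨n, h⟩ := ((eventually_gt_atTop 0).and
      (h1.eventually (eventually_le_nhds (half_pos hε)))).exists
    exact ⟨n, h.1, h.2⟩
  have hsub : ∀ s : ℝ, 0 < s → ∀ w ∈ Metric.closedBall (0 : ℂ) 1,
      ‖w - 1‖ ≤ ‖w - 1 - s‖ ∧ 0 < ‖w - 1 - s‖ := fun s hs w hw => by
    have := hre w hw
    constructor
    · rw [Complex.norm_eq_sqrt_sq_add_sq, Complex.norm_eq_sqrt_sq_add_sq]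
      refine Real.sqrt_le_sqrt ?_
      simp only [Complex.sub_re, Complex.one_re, Complex.sub_im, Complex.one_im,
        Complex.ofReal_re, Complex.ofReal_im]
      nlinarith
    · rw [norm_pos_iff]
      intro h
      have := congrArg Complex.re h
      simp at this
      linarith
  have hnexp : ∀ w : ℂ, ‖Complex.exp (n * (w - 1))‖ = Real.exp (n * (w.re - 1)) := fun w => by
    rw [Complex.norm_exp]; simp
  -- Maximum principle for `R(w) exp(n(w-1)) / (w-1-s)`. The shift `s > 0` moves the pole out of the
  -- closed disc; it is sent to `0` afterwards.
  have hmain : ∀ s : ℝ, 0 < s → ∀ w ∈ Metric.closedBall (0 : ℂ) 1,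
      ‖R w‖ * Real.exp (n * (w.re - 1)) ≤ ε / 2 * ‖w - 1 - s‖ := fun s hs w hw => by
    have hcl : closure (Metric.ball (0 : ℂ) 1) = Metric.closedBall 0 1 :=
      closure_ball _ one_ne_zero
    have hH : DiffContOnCl ℂ (fun w => R w * (Complex.exp (n * (w - 1)) * (w - 1 - s)⁻¹))
        (Metric.ball 0 1) := by
      refine hR.smul (DiffContOnCl.smul (c := fun w : ℂ => Complex.exp (n * (w - 1)))
        (f := fun w : ℂ => (w - 1 - s)⁻¹) ?_ (DiffContOnCl.inv ?_ ?_))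
      · exact (by fun_prop : Differentiable ℂ fun w : ℂ => Complex.exp (n * (w - 1))).diffContOnCl
      · exact (by fun_prop : Differentiable ℂ fun w : ℂ => (w - 1 - s)).diffContOnCl
      · exact fun x hx => norm_pos_iff.1 (hsub s hs x (hcl ▸ hx)).2
    have hmax := Complex.norm_le_of_forall_mem_frontier_norm_le (C := ε / 2)
      Metric.isBounded_ball hH (fun z hz => ?_) (hcl ▸ hw)
    · rw [norm_mul, norm_mul, hnexp, norm_inv, ← mul_assoc, ← div_eq_mul_inv,
        div_le_iff₀ (hsub s hs w hw).2] at hmax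
      exact hmax
    · rw [frontier_ball _ one_ne_zero, mem_sphere_zero_iff_norm] at hz
      have hz' : z ∈ Metric.closedBall (0 : ℂ) 1 := by simp [hz]
      rw [norm_mul, norm_mul, hnexp, norm_inv, ← mul_assoc, ← div_eq_mul_inv,
        div_le_iff₀ (hsub s hs z hz').2]
      refine le_trans ?_ (mul_le_mul_of_nonneg_left (hsub s hs z hz').1 (by positivity))
      have hsq : ‖z - 1‖ ^ 2 = 2 * (1 - z.re) := by
        rw [Complex.sq_norm, Complex.normSq_apply]
        have : z.re * z.re + z.im * z.im = 1 := by
          rw [← Complex.normSq_apply, ← Complex.sq_norm, hz, one_pow]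
        simp only [Complex.sub_re, Complex.one_re, Complex.sub_im, Complex.one_im]
        linarith
      rcases lt_or_ge ‖z - 1‖ δ₀ with h | h
      · have h1 : Real.exp (n * (z.re - 1)) ≤ 1 := by
          rw [Real.exp_le_one_iff]
          nlinarith [hre z hz']
        calc _ ≤ ‖R z‖ * 1 := by gcongr
          _ ≤ _ := by rw [mul_one]; exact hc z hz h
      · have h1 : Real.exp (n * (z.re - 1)) ≤ Real.exp (-(n * (δ₀ ^ 2 / 2))) := by
          rw [Real.exp_le_exp]
          have : δ₀ ^ 2 ≤ ‖z - 1‖ ^ 2 := by gcongr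
          nlinarith
        calc _ ≤ (|K| * ‖z - 1‖) * Real.exp (-(n * (δ₀ ^ 2 / 2))) := by
              gcongr
              exact (hK z hz').trans (by gcongr; exact le_abs_self K)
          _ = (|K| * Real.exp (-(n * (δ₀ ^ 2 / 2)))) * ‖z - 1‖ := by ring
          _ ≤ _ := by gcongr
  -- Within this distance of `1` the damping factor is at least `1/2`, so removing it turns `ε/2`
  -- into `ε`.
  refine ⟨Real.log 2 / n, by positivity, fun w hw hwδ => ?_⟩
  have hlim : ‖R w‖ * Real.exp (n * (w.re - 1)) ≤ ε / 2 * ‖w - 1‖ := by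
    have h1 : Tendsto (fun s : ℝ => ε / 2 * ‖w - 1 - s‖) (𝓝[>] 0)
        (𝓝 (ε / 2 * ‖w - 1 - (0 : ℝ)‖)) :=
      ((by fun_prop : Continuous fun s : ℝ => ε / 2 * ‖w - 1 - s‖).tendsto 0).mono_left
        nhdsWithin_le_nhds
    rw [Complex.ofReal_zero, sub_zero] at h1
    exact ge_of_tendsto h1 (eventually_mem_nhdsWithin.mono fun s hs => hmain s hs w hw)
  have h2 : 1 / 2 ≤ Real.exp (n * (w.re - 1)) := by
    have h3 : 1 - w.re ≤ ‖w - 1‖ := by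
      have := Complex.abs_re_le_norm (w - 1)
      rw [Complex.sub_re, Complex.one_re] at this
      linarith [neg_abs_le (w.re - 1)]
    rw [lt_div_iff₀ hn1] at hwδ
    calc (1 / 2 : ℝ) = Real.exp (-Real.log 2) := by
          rw [Real.exp_neg, Real.exp_log (by norm_num)]; norm_num
      _ ≤ _ := Real.exp_le_exp.2 (by nlinarith)
  nlinarith [norm_nonneg (R w)]

/-- Subtracting from the primitive `G` its first-order part at `1` leaves `R`, which is `o(|w-1|)`
on the circle by differentiability along it, hence in the disc. Cauchy's estimate on a disc about
`r` of radius comparable to `1-r` then gives `F(r) - c = R'(r) → 0`. -/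
theorem tendsto_radial_of_hasDerivAt_circle {F G : ℂ → ℂ} {L : NNReal} (hG : LipschitzWith L G)
    (hGF : ∀ w ∈ Metric.ball (0 : ℂ) 1, HasDerivAt G (F w) w) {d : ℂ}
    (hd : HasDerivAt (fun θ : ℝ => G (Complex.exp (θ * Complex.I))) d 0) :
    Tendsto (fun r : ℝ => F r) (𝓝[<] 1) (𝓝 (d / Complex.I)) := by
  set c := d / Complex.I with hcdef
  set R : ℂ → ℂ := fun w => G w - G 1 - c * (w - 1) with hRdef
  have hRd : ∀ w ∈ Metric.ball (0 : ℂ) 1, HasDerivAt R (F w - c) w := fun w hw => by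
    have h := ((hGF w hw).sub_const (G 1)).sub (((hasDerivAt_id w).sub_const 1).const_mul c)
    exact h.congr_deriv (by simp)
  have hRc : Continuous R := by
    have := hG.continuous
    fun_prop
  have hR : DiffContOnCl ℂ R (Metric.ball 0 1) :=
    ⟨fun w hw => (hRd w hw).differentiableAt.differentiableWithinAt, hRc.continuousOn⟩
  have hK : ∀ w ∈ Metric.closedBall (0 : ℂ) 1, ‖R w‖ ≤ (L + ‖c‖) * ‖w - 1‖ := fun w _ => by
    refine (norm_sub_le _ _).trans ?_
    rw [norm_mul, add_mul]
    gcongr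
    exact hG.norm_sub_le w 1
  have hcirc : ∀ ε > 0, ∃ δ > 0, ∀ w : ℂ, ‖w‖ = 1 → ‖w - 1‖ < δ → ‖R w‖ ≤ ε * ‖w - 1‖ := by
    intro ε hε
    have hRθ : HasDerivAt (fun θ : ℝ => R (Complex.exp (θ * Complex.I))) 0 0 := by
      have h1 : HasDerivAt (fun θ : ℝ => Complex.exp (θ * Complex.I)) Complex.I 0 := by
        have := ((hasDerivAt_id (0 : ℝ)).ofReal_comp.mul_const Complex.I).cexp
        simpa using this
      have := (hd.sub_const (G 1)).sub ((h1.sub_const 1).const_mul c)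
      exact this.congr_deriv (by rw [hcdef, div_mul_cancel₀ _ Complex.I_ne_zero, sub_self])
    -- The factor `2/π` compensates `|arg w| ≤ (π/2)|w-1|` on the circle.
    have h0 := (hasDerivAt_iff_isLittleO.1 hRθ).def (c := ε / Real.pi * 2) (by positivity)
    obtain ⟨δ, hδ, h1⟩ := Metric.eventually_nhds_iff.1 h0
    refine ⟨δ / Real.pi * 2, by positivity, fun w hw hwδ => ?_⟩
    have harg : |w.arg| ≤ Real.pi / 2 * ‖w - 1‖ := by
      have := Complex.angle_le_mul_norm_sub hw (norm_one (α := ℂ))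
      rwa [Complex.angle_one_right (by rintro rfl; simp at hw)] at this
    have h2 := h1 (y := w.arg) (by
      rw [dist_zero_right, Real.norm_eq_abs]
      refine harg.trans_lt ?_
      calc _ < Real.pi / 2 * (δ / Real.pi * 2) := by gcongr
        _ = δ := by field_simp)
    have hR1 : R 1 = 0 := by simp [hRdef]
    have hexp : Complex.exp (w.arg * Complex.I) = w := by
      have := Complex.norm_mul_exp_arg_mul_I w
      rwa [hw, Complex.ofReal_one, one_mul] at this
    simp only [hexp, Complex.ofReal_zero, zero_mul, Complex.exp_zero, hR1, sub_zero, smul_zero,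
      Real.norm_eq_abs] at h2
    calc _ ≤ _ := h2
      _ ≤ ε / Real.pi * 2 * (Real.pi / 2 * ‖w - 1‖) := by gcongr
      _ = _ := by field_simp
  rw [Metric.tendsto_nhdsWithin_nhds]
  intro ε hε
  obtain ⟨δ, hδ, h⟩ := littleO_at_one_of_circle hR hK hcirc (ε := ε / 8) (by positivity)
  -- The disc of radius `(1-r)/2` about `r` stays within `2(1-r) < δ` of `1`; Cauchy's estimate
  -- there gives `(ε/8)·2(1-r)/((1-r)/2) = ε/2`. The bound `1` keeps `r` positive.
  refine ⟨min (δ / 2) 1, by positivity, fun r hr1 hrd => ?_⟩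
  rw [mem_Iio] at hr1
  rw [Real.dist_eq, abs_of_neg (by linarith), lt_min_iff] at hrd
  have hsub : ∀ w ∈ Metric.closedBall (r : ℂ) ((1 - r) / 2), ‖w‖ < 1 ∧ ‖w - 1‖ ≤ 2 * (1 - r) := by
    intro w hw
    rw [mem_closedBall_iff_norm] at hw
    have h1 : ‖(r : ℂ)‖ = r := by rw [Complex.norm_real, Real.norm_of_nonneg (by linarith)]
    have h2 : ‖(r : ℂ) - 1‖ = 1 - r := by
      rw [← Complex.ofReal_one, ← Complex.ofReal_sub, Complex.norm_real, Real.norm_eq_abs,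
        abs_of_neg (by linarith)]
      ring
    have h3 := norm_add_le (w - r) (r : ℂ)
    have h4 := norm_add_le (w - r) ((r : ℂ) - 1)
    rw [sub_add_cancel] at h3
    rw [sub_add_sub_cancel] at h4
    constructor <;> linarith
  have hcau := Complex.norm_deriv_le_of_forall_mem_sphere_norm_le (f := R) (c := (r : ℂ))
    (R := (1 - r) / 2) (C := ε / 8 * (2 * (1 - r))) (by linarith)
    ⟨fun w hw => (hRd w (mem_ball_zero_iff.2 (hsub w (Metric.ball_subset_closedBall hw)).1)
      ).differentiableAt.differentiableWithinAt, hRc.continuousOn⟩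
    (fun w hw => by
      have := hsub w (Metric.sphere_subset_closedBall hw)
      refine (h w (mem_closedBall_zero_iff.2 this.1.le) (by linarith [this.2])).trans ?_
      gcongr
      exact this.2)
  rw [(hRd r (mem_ball_zero_iff.2 (hsub r (Metric.mem_closedBall_self (by linarith))).1)).deriv]
    at hcau
  rw [dist_eq_norm]
  refine hcau.trans_lt ?_
  rw [div_lt_iff₀ (by linarith)]
  nlinarith

/-- **Fatou's theorem**: a bounded holomorphic function on the disc has radial limits almost
everywhere on the circle. -/
theorem ae_exists_tendsto_radial {F : ℂ → ℂ} (hF : DifferentiableOn ℂ F (Metric.ball 0 1)) {M : ℝ}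
    (hM : ∀ w ∈ Metric.ball (0 : ℂ) 1, ‖F w‖ ≤ M) :
    ∀ᵐ θ : ℝ, ∃ c : ℂ,
      Tendsto (fun r : ℝ => F (r * Complex.exp (θ * Complex.I))) (𝓝[<] 1) (𝓝 c) := by
  -- A primitive of the bounded `F` is Lipschitz, so it extends to the plane as a Lipschitz
  -- function, whose restriction to the circle is differentiable almost everywhere.
  obtain ⟨G₀, hG₀⟩ := hF.isExactOn_ball
  have hL : LipschitzOnWith (Real.toNNReal M) G₀ (Metric.ball 0 1) := by
    refine Convex.lipschitzOnWith_of_nnnorm_hasDerivWithin_le (𝕜 := ℂ) (convex_ball _ _)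
      (fun w hw => (hG₀ w hw).hasDerivWithinAt) fun w hw => ?_
    rw [← NNReal.coe_le_coe, coe_nnnorm]
    exact (hM w hw).trans (Real.le_coe_toNNReal M)
  obtain ⟨G, hGL, hGeq⟩ := hL.extend_finite_dimension
  have hGF : ∀ w ∈ Metric.ball (0 : ℂ) 1, HasDerivAt G (F w) w := fun w hw =>
    (hG₀ w hw).congr_of_eventuallyEq
      ((hGeq.eventuallyEq_of_mem (Metric.isOpen_ball.mem_nhds hw)).symm)
  have hexpL : LipschitzWith 1 (fun θ : ℝ => Complex.exp (θ * Complex.I)) := by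
    refine lipschitzWith_of_nnnorm_deriv_le (𝕜 := ℝ) ?_ fun θ => ?_
    · exact fun θ => (((hasDerivAt_id θ).ofReal_comp.mul_const Complex.I).cexp).differentiableAt
    · have := (((hasDerivAt_id θ).ofReal_comp.mul_const Complex.I).cexp).deriv
      simp only [id] at this
      rw [this, ← NNReal.coe_le_coe, coe_nnnorm, norm_mul, Complex.norm_exp_ofReal_mul_I]
      simp
  filter_upwards [(hGL.comp hexpL).ae_differentiableAt_real] with θ hθ
  set ζ := Complex.exp (θ * Complex.I) with hζ
  have hζ1 : ‖ζ‖ = 1 := Complex.norm_exp_ofReal_mul_I θ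
  have hζ0 : ζ ≠ 0 := Complex.exp_ne_zero _
  have hmulL : LipschitzWith 1 (fun w : ℂ => ζ * w) :=
    LipschitzWith.of_dist_le_mul fun x y => by
      rw [dist_eq_norm, dist_eq_norm, ← mul_sub, norm_mul, hζ1, NNReal.coe_one]
  -- Rotation moves the boundary point `ζ` to `1`; the factor `ζ⁻¹` makes the rotated primitive have
  -- derivative `F(ζw)`.
  have hG' : LipschitzWith (1 * (_ * 1)) (fun w : ℂ => ζ⁻¹ * G (ζ * w)) :=
    LipschitzWith.comp (g := fun w => G (ζ * w)) (f := fun w => ζ⁻¹ * w)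
      (LipschitzWith.of_dist_le_mul fun x y => by
        rw [dist_eq_norm, dist_eq_norm, ← mul_sub, norm_mul, norm_inv, hζ1, NNReal.coe_one, inv_one])
      (hGL.comp hmulL)
  have hmain := tendsto_radial_of_hasDerivAt_circle (F := fun w => F (ζ * w)) hG' (fun w hw => ?_)
    (d := ζ⁻¹ * deriv (fun θ : ℝ => G (Complex.exp (θ * Complex.I))) θ) ?_
  · refine ⟨_, hmain.congr fun r => ?_⟩
    rw [mul_comm]
  · have hw' : ζ * w ∈ Metric.ball (0 : ℂ) 1 := by
      rw [mem_ball_zero_iff] at hw ⊢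
      rwa [norm_mul, hζ1, one_mul]
    have := ((hGF _ hw').comp w ((hasDerivAt_id w).const_mul ζ)).const_mul ζ⁻¹
    exact this.congr_deriv (by field_simp)
  · have h1 : HasDerivAt (fun t : ℝ => G (Complex.exp (t * Complex.I)))
        (deriv (fun θ : ℝ => G (Complex.exp (θ * Complex.I))) θ) (θ + 0) := by
      rw [add_zero]; exact hθ.hasDerivAt
    have h2 := (h1.comp_const_add θ 0).const_mul ζ⁻¹
    refine h2.congr_of_eventuallyEq (Eventually.of_forall fun t => ?_)
    simp only [hζ, ← Complex.exp_add]
    push_cast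
    ring_nf

end BergmanOrlicz

namespace BergmanOrlicz

/-! ### The surface measure of the sphere -/

instance (N : ℕ) : IsFiniteMeasure (surfaceMeasure N) := by
  unfold surfaceMeasure; infer_instance

theorem ae_norm_eq_one (N : ℕ) : ∀ᵐ ζ ∂surfaceMeasure N, ‖ζ‖ = 1 := by
  rw [surfaceMeasure, ae_map_iff (by fun_prop)
    (measurableSet_eq_fun (by fun_prop) (by fun_prop))]
  exact Eventually.of_forall fun ζ => by simp

open scoped Pointwise in
theorem surfaceMeasure_apply {N : ℕ} {s : Set (Cn N)} (hs : MeasurableSet s) :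
    surfaceMeasure N s = Module.finrank ℝ (Cn N) *
      volume (Ioo (0 : ℝ) 1 • (s ∩ Metric.sphere (0 : Cn N) 1)) := by
  rw [surfaceMeasure, Measure.map_apply (by fun_prop) hs,
    Measure.toSphere_apply' _ (hs.preimage (by fun_prop)), Subtype.image_preimage_coe, inter_comm]

theorem lintegral_polar {N : ℕ} [NeZero N] {f : Cn N → ℝ≥0∞} (hf : Measurable f) :
    ∫⁻ z, f z = ∫⁻ r in Ioi (0 : ℝ), ENNReal.ofReal (r ^ (2 * N - 1)) *
      ∫⁻ ζ, f (r • ζ) ∂surfaceMeasure N := by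
  have hdim : Module.finrank ℝ (Cn N) = 2 * N := by
    rw [finrank_real_of_complex, finrank_euclideanSpace_fin]
  have h1 := (volume : Measure (Cn N)).measurePreserving_homeomorphUnitSphereProd.lintegral_comp_emb
    (Homeomorph.measurableEmbedding _) (fun q => f ((q.2 : ℝ) • (q.1 : Cn N)))
  have hmeas : Measurable fun q : Metric.sphere (0 : Cn N) 1 × Ioi (0 : ℝ) =>
      f ((q.2 : ℝ) • (q.1 : Cn N)) := hf.comp (by fun_prop)
  rw [lintegral_prod_symm _ hmeas.aemeasurable, hdim] at h1
  have h2 : ∀ x : ({0}ᶜ : Set (Cn N)),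
      f ((((homeomorphUnitSphereProd (Cn N)) x).2 : ℝ) •
        (((homeomorphUnitSphereProd (Cn N)) x).1 : Cn N)) = f x := fun x => by
    have hx : ‖(x : Cn N)‖ ≠ 0 := norm_ne_zero_iff.2 x.2
    simp [smul_smul, hx]
  simp only [h2] at h1
  rw [lintegral_subtype_comap (measurableSet_singleton _).compl, restrict_compl_singleton] at h1
  rw [h1, Measure.volumeIoiPow, lintegral_withDensity_eq_lintegral_mul _ (by fun_prop)
    hmeas.lintegral_prod_left']
  rw [← lintegral_subtype_comap measurableSet_Ioi]
  refine lintegral_congr fun r => ?_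
  rw [Pi.mul_apply, surfaceMeasure, lintegral_map (f := fun ζ => f ((r : ℝ) • ζ)) (hf.comp (by fun_prop))
    (by fun_prop)]

-- Surface measure is a multiple of the volume of the cone over a set; `U` commutes with forming
-- cones and preserves volume.
open scoped Pointwise in
theorem map_surfaceMeasure {N : ℕ} (U : Cn N ≃ₗᵢ[ℝ] Cn N) :
    (surfaceMeasure N).map U = surfaceMeasure N := by
  ext s hs
  have hU : Measurable U := U.continuous.measurable
  rw [Measure.map_apply hU hs, surfaceMeasure_apply hs, surfaceMeasure_apply (hU hs)]
  congr 1
  rw [← U.measurePreserving.measure_preimage_equiv (f := U.toMeasurableEquiv)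
    (Ioo (0 : ℝ) 1 • (s ∩ Metric.sphere (0 : Cn N) 1))]
  congr 1
  ext z
  simp only [Set.mem_smul, mem_inter_iff, mem_preimage, mem_sphere_zero_iff_norm,
    LinearIsometryEquiv.coe_toMeasurableEquiv]
  constructor
  · rintro ⟨r, hr, ζ, ⟨h1, h2⟩, rfl⟩
    exact ⟨r, hr, U ζ, ⟨h1, by rw [U.norm_map, h2]⟩, by rw [map_smul]⟩
  · rintro ⟨r, hr, ζ, ⟨h1, h2⟩, h3⟩
    refine ⟨r, hr, U.symm ζ, ⟨by simpa using h1, by rw [U.symm.norm_map, h2]⟩, ?_⟩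
    rw [← map_smul, h3, U.symm_apply_apply]

/-- Multiplication by a unimodular complex number. -/
noncomputable def rotation (N : ℕ) (c : ℂ) (hc : ‖c‖ = 1) : Cn N ≃ₗᵢ[ℝ] Cn N :=
  ⟨(LinearEquiv.smulOfNeZero ℂ (Cn N) c (norm_pos_iff.1 (by rw [hc]; norm_num))).restrictScalars ℝ,
    fun x => by
      show ‖c • x‖ = ‖x‖
      rw [norm_smul, hc, one_mul]⟩

theorem lintegral_surfaceMeasure_rotate {N : ℕ} {g : Cn N → ℝ≥0∞} (hg : Measurable g) {c : ℂ}
    (hc : ‖c‖ = 1) :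
    ∫⁻ ζ, g (c • ζ) ∂surfaceMeasure N = ∫⁻ ζ, g ζ ∂surfaceMeasure N := by
  conv_rhs => rw [← map_surfaceMeasure (rotation N c hc),
    lintegral_map hg (rotation N c hc).continuous.measurable]
  rfl

theorem lintegral_volume_rotate {N : ℕ} (g : Cn N → ℝ≥0∞) {c : ℂ} (hc : ‖c‖ = 1) :
    ∫⁻ z : Cn N, g (c • z) = ∫⁻ z, g z :=
  (rotation N c hc).measurePreserving.lintegral_comp_emb
    (rotation N c hc).toMeasurableEquiv.measurableEmbedding g

/-! ### Nonisotropic polydiscs -/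

section Polydisc

variable {N : ℕ} [NeZero N]

/-- The polydisc in the coordinates of an orthonormal basis with radius `δ` in the first direction
and `√δ` in the other directions. -/
def polydisc (b : OrthonormalBasis (Fin N) ℂ (Cn N)) (δ : ℝ) : Set (Cn N) :=
  {w | ∀ i, ‖inner ℂ (b i) w‖ < if i = 0 then δ else √δ}

theorem isOpen_polydisc (b : OrthonormalBasis (Fin N) ℂ (Cn N)) (δ : ℝ) :
    IsOpen (polydisc b δ) := by
  simp only [polydisc, ofPred_forall]
  exact isOpen_iInter_of_finite fun i => isOpen_lt (by fun_prop) continuous_const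

theorem smul_mem_polydisc {b : OrthonormalBasis (Fin N) ℂ (Cn N)} {δ : ℝ} {c : ℂ} (hc : ‖c‖ ≤ 1)
    {w : Cn N} (hw : w ∈ polydisc b δ) : c • w ∈ polydisc b δ := fun i => by
  rw [inner_smul_right, norm_mul]
  exact (mul_le_of_le_one_left (norm_nonneg _) hc).trans_lt (hw i)

-- The first disc contributes `δ²` and each of the other `N-1` contributes `δ`. The constant also
-- absorbs the comparison, by uniqueness of Haar measure, of the Euclidean volume with the product
-- volume.
variable (N) in
theorem exists_volume_polydisc :
    ∃ c : ℝ≥0∞, c ≠ 0 ∧ c ≠ ∞ ∧ ∀ (b : OrthonormalBasis (Fin N) ℂ (Cn N)) (δ : ℝ), 0 < δ →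
      volume (polydisc b δ) = c * ENNReal.ofReal (δ ^ (N + 1)) := by
  let L := (PiLp.continuousLinearEquiv 2 ℝ (fun _ : Fin N => ℂ))
  have hH : ((volume : Measure (Cn N)).map L).IsAddHaarMeasure := L.isAddHaarMeasure_map volume
  obtain ⟨c, hc0, hct, hc⟩ : ∃ c : ℝ≥0∞, c ≠ 0 ∧ c ≠ ∞ ∧
      (volume : Measure (Cn N)).map L = c • (volume : Measure (Fin N → ℂ)) :=
    ⟨_, (Measure.addHaarScalarFactor_pos_of_isAddHaarMeasure
      ((volume : Measure (Cn N)).map L) volume).ne' |> ENNReal.coe_ne_zero.2, ENNReal.coe_ne_top,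
      Measure.isAddLeftInvariant_eq_smul _ _⟩
  refine ⟨c * NNReal.pi ^ N, mul_ne_zero hc0 (by simp [NNReal.pi_ne_zero]),
    ENNReal.mul_ne_top hct (by simp), fun b δ hδ => ?_⟩
  let V : Cn N ≃ₗᵢ[ℝ] Cn N := ⟨b.repr.toLinearEquiv.restrictScalars ℝ, b.repr.norm_map⟩
  have hV : ∀ w i, V w i = inner ℂ (b i) w := fun w i => b.repr_apply_apply w i
  set r : Fin N → ℝ := fun i => if i = 0 then δ else √δ with hr
  have hset : polydisc b δ = V ⁻¹' (L ⁻¹' (univ.pi fun i => Metric.ball (0 : ℂ) (r i))) := by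
    ext w
    simp only [polydisc, mem_ofPred_eq, mem_preimage, mem_univ_pi, mem_ball_zero_iff, ← hV]
    rfl
  have hmeas : MeasurableSet (univ.pi fun i => Metric.ball (0 : ℂ) (r i)) :=
    MeasurableSet.univ_pi fun i => Metric.isOpen_ball.measurableSet
  rw [hset, V.measurePreserving.measure_preimage
    (hmeas.preimage L.continuous.measurable).nullMeasurableSet,
    ← Measure.map_apply L.continuous.measurable hmeas, hc, Measure.smul_apply, volume_pi_pi,
    smul_eq_mul, mul_assoc]
  congr 1
  have hr2 : ∀ i, ENNReal.ofReal (r i) ^ 2 = ENNReal.ofReal δ * if i = 0 then ENNReal.ofReal δ else 1 := by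
    intro i
    simp only [hr]
    split_ifs
    · rw [sq]
    · rw [← ENNReal.ofReal_pow (Real.sqrt_nonneg _), Real.sq_sqrt hδ.le, mul_one]
  simp only [Complex.volume_ball, hr2, Finset.prod_mul_distrib, Finset.prod_const,
    Finset.card_univ, Fintype.card_fin, Finset.prod_ite_eq', Finset.mem_univ, if_true]
  rw [ENNReal.ofReal_pow hδ.le, pow_succ, mul_comm]

theorem exists_orthonormalBasis_zero {ξ : Cn N} (hξ : ‖ξ‖ = 1) :
    ∃ b : OrthonormalBasis (Fin N) ℂ (Cn N), b 0 = ξ := by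
  obtain ⟨b, hb⟩ := Orthonormal.exists_orthonormalBasis_extension_of_card_eq (𝕜 := ℂ)
    (E := Cn N) (ι := Fin N) (by simp) (v := fun _ => ξ) (s := {0}) (by
      rw [orthonormal_iff_ite]
      rintro ⟨i, rfl⟩ ⟨j, rfl⟩
      simp [hξ])
  exact ⟨b, hb 0 rfl⟩

theorem sq_norm_eq_sum (b : OrthonormalBasis (Fin N) ℂ (Cn N)) (z : Cn N) :
    ‖z‖ ^ 2 = ‖inner ℂ (b 0) z‖ ^ 2 + ∑ i ∈ Finset.univ.erase 0, ‖inner ℂ (b i) z‖ ^ 2 := by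
  rw [← b.sum_sq_norm_inner_right z, 
    Finset.add_sum_erase _ (fun i => ‖inner ℂ (b i) z‖ ^ 2) (Finset.mem_univ 0)]

end Polydisc

/-! ### Nonisotropic caps -/

/-- The nonisotropic cap of size `t` at the point `ξ` of the sphere. -/
def cap {N : ℕ} (ξ : Cn N) (t : ℝ) : Set (Cn N) := {z | ‖1 - inner ℂ ξ z‖ ≤ t}

theorem measurableSet_cap {N : ℕ} (ξ : Cn N) (t : ℝ) : MeasurableSet (cap ξ t) :=
  (isClosed_le (by fun_prop) continuous_const).measurableSet

variable {N : ℕ} [NeZero N]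

-- In the ball, `|⟨ξ,z⟩| ≥ 1-t` leaves at most `2t` for the squares of the remaining coordinates, so
-- the cap lies in a translated polydisc with parameter `4t`.
variable (N) in
theorem exists_volume_cap_le :
    ∃ c : ℝ≥0∞, c ≠ ∞ ∧ ∀ (ξ : Cn N) (t : ℝ), ‖ξ‖ = 1 → 0 < t →
      volume (cap ξ t ∩ unitBall N) ≤ c * ENNReal.ofReal (t ^ (N + 1)) := by
  obtain ⟨c, -, hct, hc⟩ := exists_volume_polydisc N
  refine ⟨c * ENNReal.ofReal (4 ^ (N + 1)), ENNReal.mul_ne_top hct ENNReal.ofReal_ne_top,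
    fun ξ t hξ ht => ?_⟩
  obtain ⟨b, rfl⟩ := exists_orthonormalBasis_zero hξ
  have hsub : cap (b 0) t ∩ unitBall N ⊆ (fun w => w + -b 0) ⁻¹' polydisc b (4 * t) := by
    rintro z ⟨hz, hzB⟩ i
    have hz1 : ‖z‖ < 1 := by simpa [unitBall] using hzB
    have hz' : ‖1 - inner ℂ (b 0) z‖ ≤ t := hz
    split_ifs with hi
    · subst hi
      rw [inner_add_right, inner_neg_right, inner_self_eq_norm_sq_to_K, hξ]
      rw [norm_sub_rev] at hz'
      simp only [RCLike.ofReal_one, one_pow, ← sub_eq_add_neg]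
      linarith
    · rw [inner_add_right, inner_neg_right, b.orthonormal.2 hi, neg_zero, add_zero]
      have h1 := sq_norm_eq_sum b z
      have h2 : ‖inner ℂ (b i) z‖ ^ 2 ≤ ∑ i ∈ Finset.univ.erase 0, ‖inner ℂ (b i) z‖ ^ 2 :=
        Finset.single_le_sum (f := fun i => ‖inner ℂ (b i) z‖ ^ 2) (fun _ _ => by positivity)
          (Finset.mem_erase.2 ⟨hi, Finset.mem_univ i⟩)
      have h3 : 1 - t ≤ ‖inner ℂ (b 0) z‖ := by
        have := norm_sub_norm_le (1 : ℂ) (inner ℂ (b 0) z)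
        rw [norm_one] at this
        linarith
      refine Real.lt_sqrt_of_sq_lt ?_
      have h4 : ‖inner ℂ (b 0) z‖ ≤ 1 := by
        have := norm_inner_le_norm (𝕜 := ℂ) (b 0) z
        rw [hξ, one_mul] at this
        linarith
      nlinarith [norm_nonneg z, norm_nonneg (inner ℂ (b 0) z)]
  refine (measure_mono hsub).trans ?_
  rw [measure_preimage_add_right, hc b (4 * t) (by positivity), mul_pow,
    ENNReal.ofReal_mul (by positivity), mul_assoc]

-- For small `t`, the spherical cap is thickened radially: for `1-t < r < 1` its dilate by `r` stays
-- in the solid cap of size `2t`. The solid cap thus has volume at least a constant times `t` times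
-- the surface measure, and dividing `t^(N+1)` by `t` gives `t^N`.
variable (N) in
theorem exists_surfaceMeasure_cap_le :
    ∃ c : ℝ≥0∞, c ≠ ∞ ∧ ∀ (ξ : Cn N) (t : ℝ), ‖ξ‖ = 1 → 0 < t →
      surfaceMeasure N (cap ξ t) ≤ c * ENNReal.ofReal (t ^ N) := by
  obtain ⟨c, hct, hc⟩ := exists_volume_cap_le N
  set c' := c * ENNReal.ofReal (2 ^ (N + 1) * 2 ^ (2 * N - 1)) +
    surfaceMeasure N univ * ENNReal.ofReal (2 ^ N) with hc'
  refine ⟨c', ?_, fun ξ t hξ ht => ?_⟩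
  · exact ENNReal.add_ne_top.2 ⟨ENNReal.mul_ne_top hct ENNReal.ofReal_ne_top,
      ENNReal.mul_ne_top (measure_ne_top _ _) ENNReal.ofReal_ne_top⟩
  -- For `t ≥ 1/2` one has `(2t)^N ≥ 1`, so the total mass is a sufficient bound.
  rcases le_or_gt (1 / 2) t with h | h
  · calc surfaceMeasure N (cap ξ t) ≤ surfaceMeasure N univ * 1 := by
          rw [mul_one]; exact measure_mono (subset_univ _)
      _ ≤ surfaceMeasure N univ * (ENNReal.ofReal (2 ^ N) * ENNReal.ofReal (t ^ N)) := by
          gcongr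
          rw [← ENNReal.ofReal_mul (by positivity), ENNReal.one_le_ofReal, ← mul_pow]
          exact one_le_pow₀ (by linarith)
      _ ≤ _ := by
          rw [← mul_assoc, hc']
          gcongr
          exact le_add_self
  · have hm : MeasurableSet (cap ξ (2 * t) ∩ unitBall N) :=
      (measurableSet_cap _ _).inter Metric.isOpen_ball.measurableSet
    have hpol := lintegral_polar (N := N) (f := (cap ξ (2 * t) ∩ unitBall N).indicator 1)
      (measurable_one.indicator hm)
    rw [lintegral_indicator_one hm] at hpol
    have hlow : ENNReal.ofReal ((1 / 2) ^ (2 * N - 1) * t) * surfaceMeasure N (cap ξ t) ≤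
        volume (cap ξ (2 * t) ∩ unitBall N) := by
      rw [hpol]
      calc _ = ∫⁻ r in Ioo (1 - t) 1, ENNReal.ofReal ((1 / 2) ^ (2 * N - 1)) *
              surfaceMeasure N (cap ξ t) := by
            rw [setLIntegral_const, Real.volume_Ioo, ENNReal.ofReal_mul (by positivity)]
            ring_nf
        _ ≤ ∫⁻ r in Ioo (1 - t) 1, ENNReal.ofReal (r ^ (2 * N - 1)) *
              ∫⁻ ζ, (cap ξ (2 * t) ∩ unitBall N).indicator 1 (r • ζ) ∂surfaceMeasure N := by
            refine setLIntegral_mono' measurableSet_Ioo fun r hr => ?_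
            have hr0 : 0 < r := by linarith [hr.1]
            gcongr
            · linarith [hr.1]
            · rw [← lintegral_indicator_one (measurableSet_cap ξ t)]
              refine lintegral_mono_ae ?_
              filter_upwards [ae_norm_eq_one N] with ζ hζ
              by_cases hz : ζ ∈ cap ξ t
              swap
              · simp [hz]
              have hz' : ‖1 - inner ℂ ξ ζ‖ ≤ t := hz
              have hi : ‖inner ℂ ξ ζ‖ ≤ 1 := by
                have := norm_inner_le_norm (𝕜 := ℂ) ξ ζ
                rwa [hξ, hζ, one_mul] at this
              rw [indicator_of_mem hz, indicator_of_mem]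
              · exact le_rfl
              refine ⟨?_, ?_⟩
              · show ‖1 - inner ℂ ξ (r • ζ)‖ ≤ 2 * t
                have e : (1 : ℂ) - inner ℂ ξ (r • ζ) =
                    (1 - inner ℂ ξ ζ) + ((1 - r : ℝ) : ℂ) * inner ℂ ξ ζ := by
                  rw [inner_smul_right_eq_smul, Complex.real_smul]; push_cast; ring
                rw [e]
                refine (norm_add_le _ _).trans ?_
                rw [norm_mul, Complex.norm_real, Real.norm_of_nonneg (by linarith [hr.2])]
                have : (1 - r) * ‖inner ℂ ξ ζ‖ ≤ (1 - r) * 1 := by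
                  gcongr
                  linarith [hr.2]
                linarith [hr.1]
              · simp only [unitBall, mem_ball_zero_iff, norm_smul, hζ, mul_one,
                  Real.norm_of_nonneg hr0.le]
                exact hr.2
        _ ≤ _ := lintegral_mono_set fun r hr => by
            rw [mem_Ioi]; linarith [hr.1]
    have h3 := hlow.trans (hc ξ (2 * t) hξ (by positivity))
    have h4 : surfaceMeasure N (cap ξ t) ≤
        c * ENNReal.ofReal ((2 * t) ^ (N + 1)) / ENNReal.ofReal ((1 / 2) ^ (2 * N - 1) * t) := by
      rw [ENNReal.le_div_iff_mul_le (Or.inl (by simp; positivity)) (Or.inl ENNReal.ofReal_ne_top),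
        mul_comm]
      exact h3
    refine h4.trans ?_
    rw [mul_div_assoc, ← ENNReal.ofReal_div_of_pos (by positivity), hc', add_mul, mul_assoc,
      ← ENNReal.ofReal_mul (by positivity)]
    refine le_trans (le_of_eq ?_) le_self_add
    congr 2
    rw [mul_pow, pow_succ t, one_div, inv_pow]
    field_simp

end BergmanOrlicz

namespace BergmanOrlicz

variable {N : ℕ} [NeZero N]

/-! ### Weighted measure of caps -/

theorem lintegral_one_sub_rpow {α t : ℝ} (hα : -1 < α) (ht : 0 < t) :
    ∫⁻ r in Ico (1 - t) 1, ENNReal.ofReal ((1 - r) ^ α) =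
      ENNReal.ofReal (t ^ (α + 1) / (α + 1)) := by
  have hi : IntervalIntegrable (fun r : ℝ => (1 - r) ^ α) volume (1 - t) 1 := by
    have h := (intervalIntegral.intervalIntegrable_rpow' (a := t) (b := 0) hα).comp_sub_left 1
    simpa using h
  rw [Measure.restrict_congr_set Ico_ae_eq_Ioc, ← ofReal_integral_eq_lintegral_ofReal,
    ← intervalIntegral.integral_of_le (by linarith),
    intervalIntegral.integral_comp_sub_left (fun x => x ^ α) 1]
  · rw [sub_self, sub_sub_cancel, integral_rpow (Or.inl hα), Real.zero_rpow (by linarith), sub_zero]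
  · exact (intervalIntegrable_iff_integrableOn_Ioc_of_le (by linarith)).1 hi
  · filter_upwards [ae_restrict_mem measurableSet_Ioc] with r hr
    exact Real.rpow_nonneg (by linarith [hr.2]) _

theorem one_sub_sq_rpow_le {α r : ℝ} (hr0 : 0 ≤ r) (hr1 : r < 1) :
    (1 - r ^ 2) ^ α ≤ 2 ^ |α| * (1 - r) ^ α := by
  have e : 1 - r ^ 2 = (1 + r) * (1 - r) := by ring
  rw [e, Real.mul_rpow (by linarith) (by linarith)]
  have : 0 ≤ (1 - r) ^ α := Real.rpow_nonneg (by linarith) _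
  gcongr
  calc (1 + r) ^ α ≤ (1 + r) ^ |α| := Real.rpow_le_rpow_of_exponent_le (by linarith) (le_abs_self α)
    _ ≤ 2 ^ |α| := Real.rpow_le_rpow (by linarith) (by linarith) (abs_nonneg α)

theorem measurable_weight (N : ℕ) (α : ℝ) :
    Measurable fun z : Cn N => ENNReal.ofReal ((1 - ‖z‖ ^ 2) ^ α) := by
  fun_prop

-- In polar coordinates, the cap meets the sphere of radius `r` only if `r ≥ 1-t`, and then within a
-- spherical cap of size `2t`. The spherical factor gives `t^N` and the radial integral of `(1-r)^α`
-- gives `t^(α+1)`.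
variable (N) in
theorem exists_weightedBallMeasure_cap_le {α : ℝ} (hα : -1 < α) :
    ∃ c : ℝ≥0∞, c ≠ ∞ ∧ ∀ (ξ : Cn N) (t : ℝ), ‖ξ‖ = 1 → 0 < t →
      weightedBallMeasure N α (cap ξ t) ≤ c * ENNReal.ofReal (t ^ ((N : ℝ) + α + 1)) := by
  obtain ⟨c, hct, hc⟩ := exists_surfaceMeasure_cap_le N
  refine ⟨c * ENNReal.ofReal (2 ^ |α| * 2 ^ N / (α + 1)), ENNReal.mul_ne_top hct
    ENNReal.ofReal_ne_top, fun ξ t hξ ht => ?_⟩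
  have hB : MeasurableSet (unitBall N) := Metric.isOpen_ball.measurableSet
  have hm := (measurableSet_cap ξ t).inter hB
  rw [weightedBallMeasure, withDensity_apply _ (measurableSet_cap ξ t),
    Measure.restrict_restrict (measurableSet_cap ξ t), ← lintegral_indicator hm,
    lintegral_polar ((measurable_weight N α).indicator hm)]
  have key : ∀ r ∈ Ioi (0 : ℝ), ENNReal.ofReal (r ^ (2 * N - 1)) *
      ∫⁻ ζ, (cap ξ t ∩ unitBall N).indicator
        (fun z : Cn N => ENNReal.ofReal ((1 - ‖z‖ ^ 2) ^ α)) (r • ζ) ∂surfaceMeasure N ≤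
      (Ico (1 - t) 1).indicator (fun r => ENNReal.ofReal ((1 - r) ^ α)) r *
        (ENNReal.ofReal (2 ^ |α|) * surfaceMeasure N (cap ξ (2 * t))) := by
    intro r hr
    rw [mem_Ioi] at hr
    have hstep : ∀ᵐ ζ ∂surfaceMeasure N, (cap ξ t ∩ unitBall N).indicator
        (fun z : Cn N => ENNReal.ofReal ((1 - ‖z‖ ^ 2) ^ α)) (r • ζ) ≤
        (Ico (1 - t) 1).indicator (fun r => ENNReal.ofReal ((1 - r) ^ α)) r *
          ENNReal.ofReal (2 ^ |α|) * (cap ξ (2 * t)).indicator 1 ζ := by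
      filter_upwards [ae_norm_eq_one N] with ζ hζ
      by_cases h : r • ζ ∈ cap ξ t ∩ unitBall N
      swap
      · simp [h]
      have hn : ‖r • ζ‖ = r := by rw [norm_smul, hζ, mul_one, Real.norm_of_nonneg hr.le]
      have hr1 : r < 1 := by
        have := h.2
        rwa [unitBall, mem_ball_zero_iff, hn] at this
      have hu : ‖1 - inner ℂ ξ (r • ζ)‖ ≤ t := h.1
      have hi : ‖inner ℂ ξ ζ‖ ≤ 1 := by
        have := norm_inner_le_norm (𝕜 := ℂ) ξ ζ
        rwa [hξ, hζ, one_mul] at this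
      have hri : ‖inner ℂ ξ (r • ζ)‖ ≤ r := by
        have := norm_inner_le_norm (𝕜 := ℂ) ξ (r • ζ)
        rwa [hξ, hn, one_mul] at this
      have hrt : 1 - t ≤ r := by
        have := norm_sub_norm_le (1 : ℂ) (inner ℂ ξ (r • ζ))
        rw [norm_one] at this
        linarith
      have hcap : ζ ∈ cap ξ (2 * t) := by
        show ‖1 - inner ℂ ξ ζ‖ ≤ 2 * t
        have e : (1 : ℂ) - inner ℂ ξ ζ =
            (1 - inner ℂ ξ (r • ζ)) - ((1 - r : ℝ) : ℂ) * inner ℂ ξ ζ := by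
          rw [inner_smul_right_eq_smul, Complex.real_smul]; push_cast; ring
        rw [e]
        refine (norm_sub_le _ _).trans ?_
        rw [norm_mul, Complex.norm_real, Real.norm_of_nonneg (by linarith)]
        have : (1 - r) * ‖inner ℂ ξ ζ‖ ≤ (1 - r) * 1 := by
          gcongr
        linarith
      have hrI : r ∈ Ico (1 - t) 1 := ⟨hrt, hr1⟩
      rw [indicator_of_mem h, indicator_of_mem hrI,
        indicator_of_mem hcap, Pi.one_apply, mul_one, hn, mul_comm,
        ← ENNReal.ofReal_mul (by positivity)]
      exact ENNReal.ofReal_le_ofReal (one_sub_sq_rpow_le hr.le hr1)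
    by_cases hrI : r ∈ Ico (1 - t) 1
    · calc _ ≤ 1 * ∫⁻ ζ, (cap ξ t ∩ unitBall N).indicator
              (fun z : Cn N => ENNReal.ofReal ((1 - ‖z‖ ^ 2) ^ α)) (r • ζ) ∂surfaceMeasure N := by
            gcongr
            rw [ENNReal.ofReal_le_one]
            exact pow_le_one₀ hr.le hrI.2.le
        _ ≤ _ := by
            rw [one_mul]
            refine (lintegral_mono_ae hstep).trans ?_
            rw [lintegral_const_mul _ (measurable_one.indicator (measurableSet_cap _ _)),
              lintegral_indicator_one (measurableSet_cap _ _), mul_assoc]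
    · have : ∫⁻ ζ, (cap ξ t ∩ unitBall N).indicator
              (fun z : Cn N => ENNReal.ofReal ((1 - ‖z‖ ^ 2) ^ α)) (r • ζ) ∂surfaceMeasure N = 0 := by
        refine le_antisymm ((lintegral_mono_ae hstep).trans ?_) (zero_le)
        simp [hrI]
      rw [this, mul_zero]
      exact zero_le
  refine (setLIntegral_mono' measurableSet_Ioi key).trans ?_
  rw [lintegral_mul_const _ (by
    refine Measurable.indicator ?_ measurableSet_Ico
    fun_prop)]
  refine (mul_le_mul_left (setLIntegral_le_lintegral _ _) _).trans ?_
  rw [lintegral_indicator measurableSet_Ico, lintegral_one_sub_rpow hα ht]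
  refine (mul_le_mul_right (mul_le_mul_right (hc ξ (2 * t) hξ (by positivity)) _) _).trans ?_
  have hα1 : 0 < α + 1 := by linarith
  have e : t ^ ((N : ℝ) + α + 1) = t ^ N * t ^ (α + 1) := by
    rw [add_assoc, Real.rpow_add ht, Real.rpow_natCast]
  rw [show ∀ a b d : ℝ≥0∞, a * (b * (c * d)) = c * (a * (b * d)) by intros; ring, mul_assoc,
    ← ENNReal.ofReal_mul (by positivity), ← ENNReal.ofReal_mul (by positivity),
    ← ENNReal.ofReal_mul (by positivity), e, mul_pow]
  refine le_of_eq ?_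
  congr 2
  ring

/-! ### The probability measures `v_α` -/

omit [NeZero N] in
theorem norm_sub_le_two {ξ z : Cn N} (hξ : ‖ξ‖ = 1) (hz : ‖z‖ ≤ 1) : ‖1 - inner ℂ ξ z‖ ≤ 2 := by
  have h1 := norm_inner_le_norm (𝕜 := ℂ) ξ z
  have h2 := norm_sub_le (1 : ℂ) (inner ℂ ξ z)
  rw [hξ, one_mul] at h1
  rw [norm_one] at h2
  linarith

theorem ae_mem_unitBall_weighted (N : ℕ) (α : ℝ) :
    ∀ᵐ z ∂weightedBallMeasure N α, z ∈ unitBall N :=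
  (withDensity_absolutelyContinuous _ _).ae_le (ae_restrict_mem Metric.isOpen_ball.measurableSet)

theorem weightedBallMeasure_univ_ne_top {α : ℝ} (hα : -1 < α) :
    weightedBallMeasure N α univ ≠ ∞ := by
  obtain ⟨c, hct, hc⟩ := exists_weightedBallMeasure_cap_le N hα
  obtain ⟨ξ, hξ⟩ := exists_norm_eq (Cn N) zero_le_one
  -- The whole ball lies in a cap of size `2`.
  refine ne_top_of_le_ne_top (ENNReal.mul_ne_top hct ENNReal.ofReal_ne_top)
    ((measure_mono_ae ?_).trans (hc ξ 2 hξ two_pos))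
  filter_upwards [ae_mem_unitBall_weighted N α] with z hz _
  exact norm_sub_le_two hξ (mem_ball_zero_iff.1 hz).le

omit [NeZero N] in
theorem weightedBallMeasure_univ_ne_zero (α : ℝ) : weightedBallMeasure N α univ ≠ 0 := by
  intro h
  rw [weightedBallMeasure, withDensity_apply _ MeasurableSet.univ, Measure.restrict_univ,
    lintegral_eq_zero_iff (measurable_weight N α)] at h
  rw [Filter.EventuallyEq, ae_restrict_iff' (show MeasurableSet (unitBall N) from
    Metric.isOpen_ball.measurableSet)] at h
  have h0 : (volume : Measure (Cn N)) (unitBall N) = 0 := by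
    refine measure_mono_null (fun z hz => ?_) h
    intro hz0
    have h1 := hz0 hz
    have hz1 : ‖z‖ < 1 := mem_ball_zero_iff.1 hz
    rw [Pi.zero_apply, ENNReal.ofReal_eq_zero] at h1
    exact absurd h1 (not_le.2 (Real.rpow_pos_of_pos (by nlinarith [norm_nonneg z]) _))
  exact (Metric.measure_ball_pos volume (0 : Cn N) one_pos).ne' h0

theorem surfaceMeasure_univ_ne_zero : surfaceMeasure N univ ≠ 0 := by
  rw [surfaceMeasure, Measure.map_apply (by fun_prop) MeasurableSet.univ, preimage_univ,
    Measure.measure_univ_ne_zero]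
  exact Measure.toSphere_ne_zero _

theorem vMeasure_neg_one (N : ℕ) :
    vMeasure N (-1) = (surfaceMeasure N univ)⁻¹ • surfaceMeasure N := if_pos rfl

theorem vMeasure_of_ne (N : ℕ) {α : ℝ} (hα : α ≠ -1) :
    vMeasure N α = (weightedBallMeasure N α univ)⁻¹ • weightedBallMeasure N α := if_neg hα

theorem isProbabilityMeasure_vMeasure {α : ℝ} (hα : -1 ≤ α) :
    IsProbabilityMeasure (vMeasure N α) := by
  constructor
  rcases hα.eq_or_lt with rfl | h
  · rw [vMeasure_neg_one, Measure.smul_apply, smul_eq_mul,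
      ENNReal.inv_mul_cancel surfaceMeasure_univ_ne_zero (measure_ne_top _ _)]
  · rw [vMeasure_of_ne N h.ne', Measure.smul_apply, smul_eq_mul,
      ENNReal.inv_mul_cancel (weightedBallMeasure_univ_ne_zero α)
        (weightedBallMeasure_univ_ne_top h)]

variable (N) in
theorem exists_vMeasure_cap_le {α : ℝ} (hα : -1 ≤ α) :
    ∃ c : ℝ≥0∞, c ≠ ∞ ∧ ∀ (ξ : Cn N) (t : ℝ), ‖ξ‖ = 1 → 0 < t →
      vMeasure N α (cap ξ t) ≤ c * ENNReal.ofReal (t ^ ((N : ℝ) + α + 1)) := by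
  rcases hα.eq_or_lt with rfl | h
  · obtain ⟨c, hct, hc⟩ := exists_surfaceMeasure_cap_le N
    refine ⟨(surfaceMeasure N univ)⁻¹ * c, ENNReal.mul_ne_top
      (ENNReal.inv_ne_top.2 surfaceMeasure_univ_ne_zero) hct, fun ξ t hξ ht => ?_⟩
    rw [vMeasure_neg_one, Measure.smul_apply, smul_eq_mul, mul_assoc, neg_add_cancel_right,
      Real.rpow_natCast]
    gcongr
    exact hc ξ t hξ ht
  · obtain ⟨c, hct, hc⟩ := exists_weightedBallMeasure_cap_le N h
    refine ⟨(weightedBallMeasure N α univ)⁻¹ * c, ENNReal.mul_ne_top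
      (ENNReal.inv_ne_top.2 (weightedBallMeasure_univ_ne_zero α)) hct, fun ξ t hξ ht => ?_⟩
    rw [vMeasure_of_ne N h.ne', Measure.smul_apply, smul_eq_mul, mul_assoc]
    gcongr
    exact hc ξ t hξ ht

omit [NeZero N] in
theorem ae_vMeasure_norm_lt_one {α : ℝ} (hα : α ≠ -1) : ∀ᵐ z ∂vMeasure N α, z ∈ unitBall N := by
  rw [vMeasure_of_ne N hα]
  exact (Measure.smul_absolutelyContinuous).ae_le (ae_mem_unitBall_weighted N α)

omit [NeZero N] in
theorem ae_vMeasure_norm_eq_one : ∀ᵐ z ∂vMeasure N (-1), ‖z‖ = 1 := by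
  rw [vMeasure_neg_one]
  exact (Measure.smul_absolutelyContinuous).ae_le (ae_norm_eq_one N)

omit [NeZero N] in
theorem ae_vMeasure_norm_le_one (α : ℝ) : ∀ᵐ z ∂vMeasure N α, ‖z‖ ≤ 1 := by
  by_cases h : α = -1
  · subst h
    exact ae_vMeasure_norm_eq_one.mono fun z hz => hz.le
  · exact (ae_vMeasure_norm_lt_one h).mono fun z hz => (mem_ball_zero_iff.1 hz).le

end BergmanOrlicz

namespace BergmanOrlicz

variable {N : ℕ} [NeZero N]

/-! ### Point evaluations on Bergman-Orlicz and Hardy-Orlicz spaces -/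

open Classical in
/-- The modular defining the norm of `A_α^ψ` is at most `1` at `K`. -/
def UnitModular (N : ℕ) (α : ℝ) (ψ : ℝ → ℝ) (f : Cn N → ℂ) (K : ℝ) : Prop :=
  if α = -1 then
    ∀ r ∈ Ioo (0 : ℝ) 1, modular ψ (vMeasure N (-1)) (fun ζ : Cn N => f (r • ζ)) K ≤ 1
  else modular ψ (vMeasure N α) f K ≤ 1

omit [NeZero N] in
theorem unitModular_of_spaceNorm_lt {α : ℝ} {ψ : ℝ → ℝ} (hψ : IsOrlicz ψ) {f : Cn N → ℂ} {K : ℝ}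
    (h : spaceNorm N α ψ f < ENNReal.ofReal K) : UnitModular N α ψ f K := by
  unfold UnitModular
  unfold spaceNorm at h
  split_ifs at h ⊢
  · intro r hr
    refine modular_le_one_of_luxemburgNorm_lt hψ (lt_of_le_of_lt ?_ h)
    exact le_iSup₂ (f := fun (r : ℝ) (_ : r ∈ Ioo (0 : ℝ) 1) =>
      luxemburgNorm ψ (vMeasure N (-1)) (fun ζ : Cn N => f (r • ζ))) r hr
  · exact modular_le_one_of_luxemburgNorm_lt hψ h

omit [NeZero N] in
theorem spaceNorm_le_of_unitModular {α : ℝ} {ψ : ℝ → ℝ} {f : Cn N → ℂ} {K : ℝ}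
    (hK : 0 < K) (h : UnitModular N α ψ f K) : spaceNorm N α ψ f ≤ ENNReal.ofReal K := by
  unfold UnitModular at h
  unfold spaceNorm
  split_ifs at h ⊢
  · exact iSup₂_le fun r hr => luxemburgNorm_le hK (h r hr)
  · exact luxemburgNorm_le hK h

omit [NeZero N] in
theorem measurable_indicator_modular {ψ : ℝ → ℝ} (hψ : IsOrlicz ψ) {f : Cn N → ℂ}
    (hf : ContinuousOn f (unitBall N)) {K : ℝ} (hK : 0 < K) {s : Set (Cn N)} (hs : MeasurableSet s)
    (hsB : s ⊆ unitBall N) :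
    Measurable (s.indicator fun z => ENNReal.ofReal (ψ (‖f z‖ / K))) := by
  classical
  rw [← piecewise_eq_indicator]
  refine ContinuousOn.measurable_piecewise ?_ continuousOn_const hs
  refine ENNReal.continuous_ofReal.comp_continuousOn ?_
  exact hψ.continuousOn.comp ((hf.mono hsB).norm.div_const K)
    fun z _ => mem_Ici.2 (by positivity)

/-- The shell of points of the ball at distance about `s` from the sphere. -/
def shell (N : ℕ) (s : ℝ) : Set (Cn N) := {z | z ∈ unitBall N ∧ s / 4 ≤ 1 - ‖z‖ ∧ 1 - ‖z‖ ≤ 2 * s}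

omit [NeZero N] in
theorem measurableSet_shell (s : ℝ) : MeasurableSet (shell N s) :=
  Metric.isOpen_ball.measurableSet.inter
    ((measurableSet_le measurable_const (measurable_norm.const_sub 1)).inter
      (measurableSet_le (measurable_norm.const_sub 1) measurable_const))

/-- On the shell, `q = 1-|z|²` is within a factor `4` of `s`; the exponent `|α|` covers both signs
of `α`. -/
theorem one_le_weight {α s q : ℝ} (hs : 0 < s) (h1 : s / 4 ≤ q) (h2 : q ≤ 4 * s) :
    1 ≤ 4 ^ |α| * s ^ (-α) * q ^ α := by
  have hq : 0 < q := by linarith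
  rw [Real.rpow_neg hs.le, mul_assoc, inv_mul_eq_div, ← Real.div_rpow hq.le hs.le]
  have h3 : 1 / 4 ≤ q / s := by rw [le_div_iff₀ hs]; linarith
  have h4 : q / s ≤ 4 := by rw [div_le_iff₀ hs]; linarith
  have h5 : 0 < q / s := by positivity
  rcases le_total 0 α with h | h
  · rw [abs_of_nonneg h, ← Real.mul_rpow (by norm_num) h5.le]
    exact Real.one_le_rpow (by linarith) h
  · rw [abs_of_nonpos h, Real.rpow_neg (by norm_num), inv_mul_eq_div,
      ← Real.div_rpow h5.le (by norm_num)]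
    exact Real.one_le_rpow_of_pos_of_le_one_of_nonpos (by positivity)
      (by rw [div_le_one (by norm_num)]; exact h4) h

-- This is an integral against unweighted volume, to be fed by the submean value inequality. For `α
-- > -1` the weight is comparable to `s^α` on the shell and can be divided out. For `α = -1` each
-- sphere contributes at most the total surface mass, and the shell has thickness at most `2s`.
variable (N) in
theorem exists_lintegral_shell_le {α : ℝ} (hα : -1 ≤ α) :
    ∃ C : ℝ≥0∞, C ≠ ∞ ∧ ∀ (ψ : ℝ → ℝ), IsOrlicz ψ → ∀ (f : Cn N → ℂ) (K s : ℝ),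
      ContinuousOn f (unitBall N) → 0 < K → UnitModular N α ψ f K → 0 < s →
      ∫⁻ z in shell N s, ENNReal.ofReal (ψ (‖f z‖ / K)) ≤ C * ENNReal.ofReal (s ^ (-α)) := by
  rcases hα.eq_or_lt with rfl | h
  · refine ⟨surfaceMeasure N univ * 2, ENNReal.mul_ne_top (measure_ne_top _ _) (by simp),
      fun ψ hψ f K s hf hK hmod hs => ?_⟩
    have hmeas := measurable_indicator_modular hψ hf hK (measurableSet_shell s) (fun z hz => hz.1)
    rw [UnitModular, if_pos rfl] at hmod
    rw [← lintegral_indicator (measurableSet_shell s), lintegral_polar hmeas]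
    have key : ∀ r ∈ Ioi (0 : ℝ), ENNReal.ofReal (r ^ (2 * N - 1)) *
        ∫⁻ ζ, (shell N s).indicator (fun z => ENNReal.ofReal (ψ (‖f z‖ / K))) (r • ζ)
          ∂surfaceMeasure N ≤ (Ico (1 - 2 * s) 1).indicator (fun _ => surfaceMeasure N univ) r := by
      intro r hr
      rw [mem_Ioi] at hr
      by_cases hrI : r ∈ Ico (1 - 2 * s) 1
      · rw [indicator_of_mem hrI]
        calc _ ≤ 1 * ∫⁻ ζ, ENNReal.ofReal (ψ (‖f (r • ζ)‖ / K)) ∂surfaceMeasure N := by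
              gcongr
              · rw [ENNReal.ofReal_le_one]
                exact pow_le_one₀ hr.le hrI.2.le
              · exact indicator_le_self _ _ _
          _ ≤ _ := by
              have h1 := hmod r ⟨hr, hrI.2⟩
              rw [vMeasure_neg_one, modular, lintegral_smul_measure, smul_eq_mul,
                ENNReal.inv_mul_le_iff surfaceMeasure_univ_ne_zero (measure_ne_top _ _),
                mul_one] at h1
              rwa [one_mul]
      · rw [indicator_of_notMem hrI]
        refine le_of_eq ?_
        rw [lintegral_eq_zero_of_ae_eq_zero, mul_zero]
        filter_upwards [ae_norm_eq_one N] with ζ hζ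
        rw [Pi.zero_apply, indicator_of_notMem]
        rintro ⟨h1, -, h3⟩
        have hn : ‖r • ζ‖ = r := by rw [norm_smul, hζ, mul_one, Real.norm_of_nonneg hr.le]
        rw [unitBall, mem_ball_zero_iff, hn] at h1
        rw [hn] at h3
        exact hrI ⟨by linarith, h1⟩
    refine (setLIntegral_mono' measurableSet_Ioi key).trans ((setLIntegral_le_lintegral _ _).trans ?_)
    rw [lintegral_indicator measurableSet_Ico, setLIntegral_const, Real.volume_Ico, neg_neg,
      Real.rpow_one, mul_assoc, sub_sub_cancel, ENNReal.ofReal_mul (by norm_num)]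
    simp
  · refine ⟨ENNReal.ofReal (4 ^ |α|) * weightedBallMeasure N α univ,
      ENNReal.mul_ne_top ENNReal.ofReal_ne_top (weightedBallMeasure_univ_ne_top h),
      fun ψ hψ f K s hf hK hmod hs => ?_⟩
    have hmeas := measurable_indicator_modular hψ hf hK (measurableSet_shell s) (fun z hz => hz.1)
    rw [UnitModular, if_neg h.ne', vMeasure_of_ne N h.ne', modular, lintegral_smul_measure,
      smul_eq_mul, ENNReal.inv_mul_le_iff (weightedBallMeasure_univ_ne_zero α)
      (weightedBallMeasure_univ_ne_top h), mul_one] at hmod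
    set g := (shell N s).indicator fun z => ENNReal.ofReal (ψ (‖f z‖ / K)) with hg
    have h1 : ∫⁻ z, g z ∂weightedBallMeasure N α ≤ weightedBallMeasure N α univ :=
      (lintegral_mono fun z => indicator_le_self _ _ _).trans hmod
    rw [weightedBallMeasure, lintegral_withDensity_eq_lintegral_mul _ (measurable_weight N α) hmeas,
      ← weightedBallMeasure] at h1
    have h2 : ∫⁻ z in shell N s, ENNReal.ofReal (ψ (‖f z‖ / K)) ≤
        ∫⁻ z in unitBall N, ENNReal.ofReal (4 ^ |α| * s ^ (-α)) *
          (ENNReal.ofReal ((1 - ‖z‖ ^ 2) ^ α) * g z) := by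
      rw [← lintegral_indicator (measurableSet_shell s),
        ← lintegral_indicator (show MeasurableSet (unitBall N) from
          Metric.isOpen_ball.measurableSet)]
      refine lintegral_mono fun z => ?_
      by_cases hz : z ∈ shell N s
      swap
      · rw [indicator_of_notMem hz]; exact zero_le
      rw [indicator_of_mem hz.1, hg, indicator_of_mem hz, ← mul_assoc,
        ← ENNReal.ofReal_mul (by positivity)]
      refine le_mul_of_one_le_left (zero_le) ?_
      rw [ENNReal.one_le_ofReal]
      obtain ⟨hzB, hz1, hz2⟩ := hz
      have hzB' : ‖z‖ < 1 := mem_ball_zero_iff.1 hzB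
      have e : 1 - ‖z‖ ^ 2 = (1 + ‖z‖) * (1 - ‖z‖) := by ring
      have hz0 := norm_nonneg z
      exact one_le_weight hs (by nlinarith) (by nlinarith)
    refine h2.trans ?_
    rw [lintegral_const_mul' _ _ ENNReal.ofReal_ne_top, ENNReal.ofReal_mul (by positivity)]
    calc _ ≤ ENNReal.ofReal (4 ^ |α|) * ENNReal.ofReal (s ^ (-α)) *
          weightedBallMeasure N α univ := by gcongr; exact h1
      _ = _ := by ring

omit [NeZero N] in
theorem differentiableOn_slice {F : Type*} [NormedAddCommGroup F] [NormedSpace ℂ F] {f : Cn N → F}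
    (hf : DifferentiableOn ℂ f (unitBall N)) (a w : Cn N) {S : Set ℂ}
    (hS : ∀ c ∈ S, a + c • w ∈ unitBall N) : DifferentiableOn ℂ (fun c : ℂ => f (a + c • w)) S :=
  hf.comp (by fun_prop) hS

/-- Submean value inequality on polydiscs. -/
theorem modular_mul_volume_polydisc_le {ψ : ℝ → ℝ} (hψ : IsOrlicz ψ) {f : Cn N → ℂ}
    (hf : DifferentiableOn ℂ f (unitBall N)) {K : ℝ} (hK : 0 < K)
    (b : OrthonormalBasis (Fin N) ℂ (Cn N)) {δ : ℝ} {a : Cn N} {S : Set (Cn N)}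
    (hS : MeasurableSet S) (hSB : S ⊆ unitBall N) (h : ∀ w ∈ polydisc b δ, a + w ∈ S) :
    ENNReal.ofReal (ψ (‖f a‖ / K)) * volume (polydisc b δ) ≤
      ∫⁻ z in S, ENNReal.ofReal (ψ (‖f z‖ / K)) := by
  obtain ⟨ν, hν, hJ⟩ := exists_poisson_jensen hψ (R := 1) (w := 0) (by simp)
  have hmeasS := measurable_indicator_modular hψ hf.continuousOn hK hS hSB
  set g : Cn N → ℝ≥0∞ := fun w => S.indicator (fun z => ENNReal.ofReal (ψ (‖f z‖ / K))) (a + w)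
    with hg
  have hgm : Measurable g := hmeasS.comp (by fun_prop)
  -- Jensen at the centre of the disc `c ↦ a + c·w`. The polydisc is invariant under rotations, so
  -- integrating over `w` and exchanging the integrals removes the rotation.
  have hpt : ∀ w ∈ polydisc b δ, ENNReal.ofReal (ψ (‖f a‖ / K)) ≤
      ∫⁻ θ, g (circleMap 0 1 θ • w) ∂ν := by
    intro w hw
    have hmem : ∀ c : ℂ, ‖c‖ ≤ 1 → a + c • w ∈ S := fun c hc => h _ (smul_mem_polydisc hc hw)
    have hd : DiffContOnCl ℂ (fun c : ℂ => f (a + c • w)) (Metric.ball 0 1) := by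
      refine DifferentiableOn.diffContOnCl ?_
      rw [closure_ball _ one_ne_zero]
      exact differentiableOn_slice hf a w fun c hc => hSB (hmem c (mem_closedBall_zero_iff.1 hc))
    have h1 := hJ _ hd K hK
    rw [zero_smul, add_zero] at h1
    refine h1.trans (le_of_eq (lintegral_congr fun θ => ?_))
    rw [hg]
    simp only
    rw [indicator_of_mem (hmem _ (by simp))]
  rw [← setLIntegral_const]
  calc _ ≤ ∫⁻ w in polydisc b δ, ∫⁻ θ, g (circleMap 0 1 θ • w) ∂ν :=
        setLIntegral_mono' (isOpen_polydisc b δ).measurableSet hpt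
    _ ≤ ∫⁻ w, ∫⁻ θ, g (circleMap 0 1 θ • w) ∂ν := setLIntegral_le_lintegral _ _
    _ = ∫⁻ θ, (∫⁻ w, g (circleMap 0 1 θ • w)) ∂ν :=
        lintegral_lintegral_swap (hgm.comp (by fun_prop)).aemeasurable
    _ = ∫⁻ θ, (∫⁻ w, g w) ∂ν := by
        refine lintegral_congr fun θ => lintegral_volume_rotate g (by simp)
    _ = ∫⁻ w, g w := by simp
    _ = _ := by
        rw [hg, lintegral_add_left_eq_self (S.indicator fun z => ENNReal.ofReal (ψ (‖f z‖ / K))) a,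
          lintegral_indicator hS]

/-- The first coordinate has modulus at most `1-s+δ`, and the others add at most `Nδ` to `|z|²`. The
choice of `δ` makes `(N+1)δ = s/4`, hence `|z|² ≤ 1 - 3s/4`. -/
theorem add_polydisc_subset_shell {b : OrthonormalBasis (Fin N) ℂ (Cn N)} {s : ℝ} (hs : 0 < s)
    (hs1 : s ≤ 1) {w : Cn N} (hw : w ∈ polydisc b (s / (4 * (N + 1)))) :
    ((1 - s : ℝ) : ℂ) • b 0 + w ∈ shell N s := by
  set δ := s / (4 * ((N : ℝ) + 1)) with hδ
  have hδ0 : 0 < δ := by positivity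
  have hδs : δ * (N + 1) = s / 4 := by rw [hδ]; field_simp
  have hN0 : (0 : ℝ) ≤ N := Nat.cast_nonneg N
  have hδ4 : δ ≤ s / 4 := by nlinarith
  set z := ((1 - s : ℝ) : ℂ) • b 0 + w with hz
  have h0 : inner ℂ (b 0) z = ((1 - s : ℝ) : ℂ) + inner ℂ (b 0) w := by
    rw [hz, inner_add_right, inner_smul_right, inner_self_eq_norm_sq_to_K, b.norm_eq_one]
    simp
  have hi : ∀ i, i ≠ 0 → inner ℂ (b i) z = inner ℂ (b i) w := fun i hi => by
    rw [hz, inner_add_right, inner_smul_right, b.orthonormal.2 hi, mul_zero, zero_add]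
  have hw0 : ‖inner ℂ (b 0) w‖ < δ := by simpa using hw 0
  have hnc : ‖((1 - s : ℝ) : ℂ)‖ = 1 - s := by
    rw [Complex.norm_real, Real.norm_of_nonneg (by linarith)]
  have hz0u : ‖inner ℂ (b 0) z‖ ≤ 1 - s + δ := by
    rw [h0]
    refine (norm_add_le _ _).trans ?_
    rw [hnc]; linarith
  have hz0l : 1 - s - δ ≤ ‖inner ℂ (b 0) z‖ := by
    rw [h0]
    have := norm_sub_le_norm_add ((1 - s : ℝ) : ℂ) (inner ℂ (b 0) w)
    rw [hnc] at this
    linarith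
  have hzl : ‖inner ℂ (b 0) z‖ ≤ ‖z‖ := by
    have := norm_inner_le_norm (𝕜 := ℂ) (b 0) z
    rwa [b.norm_eq_one, one_mul] at this
  have hsum : ∑ i ∈ Finset.univ.erase 0, ‖inner ℂ (b i) z‖ ^ 2 ≤ N * δ := by
    calc _ ≤ ∑ i ∈ Finset.univ.erase (0 : Fin N), δ := by
          refine Finset.sum_le_sum fun i hi0 => ?_
          have hne := (Finset.mem_erase.1 hi0).1
          rw [hi i hne]
          have := hw i
          rw [if_neg hne] at this
          rw [← Real.sq_sqrt hδ0.le]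
          gcongr
      _ ≤ _ := by
          rw [Finset.sum_const, nsmul_eq_mul]
          gcongr
          exact (Finset.card_erase_le).trans (by simp)
  have hsq := sq_norm_eq_sum b z
  have hsq1 : ‖z‖ ^ 2 ≤ 1 - 3 * s / 4 := by
    have : ‖inner ℂ (b 0) z‖ ^ 2 ≤ 1 - s + δ := by
      have := norm_nonneg (inner ℂ (b 0) z)
      nlinarith
    nlinarith
  have hz1 : ‖z‖ < 1 := by
    have := norm_nonneg z
    nlinarith
  refine ⟨mem_ball_zero_iff.2 hz1, ?_, by linarith⟩
  nlinarith [norm_nonneg z]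

theorem exists_eq_smul_unit (a : Cn N) : ∃ ξ : Cn N, ‖ξ‖ = 1 ∧ a = ((‖a‖ : ℝ) : ℂ) • ξ := by
  by_cases ha : a = 0
  · obtain ⟨ξ, hξ⟩ := exists_norm_eq (Cn N) zero_le_one
    exact ⟨ξ, hξ, by simp [ha]⟩
  · have hn : (‖a‖ : ℂ) ≠ 0 := by simpa using ha
    exact ⟨((‖a‖ : ℝ) : ℂ)⁻¹ • a, by simp [norm_smul, ha], by rw [smul_smul, mul_inv_cancel₀ hn, one_smul]⟩

-- The submean value inequality on a polydisc of volume of order `s^(N+1)`, contained in a shell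
-- where the integral is at most of order `s^(-α)`.
variable (N) in
theorem exists_modular_point_le {α : ℝ} (hα : -1 ≤ α) :
    ∃ C : ℝ, 1 ≤ C ∧ ∀ (ψ : ℝ → ℝ), IsOrlicz ψ → ∀ (f : Cn N → ℂ) (K : ℝ),
      DifferentiableOn ℂ f (unitBall N) → 0 < K → UnitModular N α ψ f K → ∀ a ∈ unitBall N,
      ψ (‖f a‖ / K) ≤ C * (1 / (1 - ‖a‖) ^ ((N : ℝ) + α + 1)) := by
  obtain ⟨C, hCt, hC⟩ := exists_lintegral_shell_le N hα
  obtain ⟨c, hc0, hct, hc⟩ := exists_volume_polydisc N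
  set D : ℝ := (C / c).toReal * (4 * ((N : ℝ) + 1)) ^ (N + 1) with hD
  -- A constant at least `1` can be pulled out of `ψ⁻¹` by `inv_mul_le`.
  refine ⟨max 1 D, le_max_left _ _, fun ψ hψ f K hf hK hmod a ha => ?_⟩
  obtain ⟨ξ, hξ, haξ⟩ := exists_eq_smul_unit a
  obtain ⟨b, rfl⟩ := exists_orthonormalBasis_zero hξ
  have ha1 : ‖a‖ < 1 := mem_ball_zero_iff.1 ha
  set s := 1 - ‖a‖ with hs
  have hs0 : 0 < s := by linarith
  have hs1 : s ≤ 1 := by linarith [norm_nonneg a]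
  have ha' : a = ((1 - s : ℝ) : ℂ) • b 0 := by rw [hs, sub_sub_cancel]; exact haξ
  have h1 := modular_mul_volume_polydisc_le hψ hf hK b (δ := s / (4 * (N + 1))) (a := a)
    (measurableSet_shell s) (fun z hz => hz.1) (fun w hw => by
      rw [ha']; exact add_polydisc_subset_shell hs0 hs1 hw)
  rw [hc b _ (by positivity)] at h1
  have h2 := h1.trans (hC ψ hψ f K s hf.continuousOn hK hmod hs0)
  have h3 : ENNReal.ofReal (ψ (‖f a‖ / K)) ≤
      (C / c) * (ENNReal.ofReal (s ^ (-α)) / ENNReal.ofReal ((s / (4 * (N + 1))) ^ (N + 1))) := by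
    have hne : ENNReal.ofReal ((s / (4 * ((N : ℝ) + 1))) ^ (N + 1)) ≠ 0 := by
      simp only [ne_eq, ENNReal.ofReal_eq_zero, not_le]; positivity
    rw [← mul_assoc, mul_right_comm, ← ENNReal.le_div_iff_mul_le (Or.inl hc0) (Or.inl hct),
      ← ENNReal.le_div_iff_mul_le (Or.inl hne) (Or.inl ENNReal.ofReal_ne_top)] at h2
    refine h2.trans (le_of_eq ?_)
    simp only [div_eq_mul_inv]
    ring
  rw [← ENNReal.ofReal_div_of_pos (by positivity),
    ← ENNReal.ofReal_toReal (ENNReal.div_ne_top hCt hc0),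
    ← ENNReal.ofReal_mul ENNReal.toReal_nonneg, ENNReal.ofReal_le_ofReal_iff (by positivity)] at h3
  refine h3.trans ?_
  have e : s ^ ((N : ℝ) + α + 1) = s ^ (N + 1) * s ^ α := by
    rw [add_right_comm, Real.rpow_add hs0, ← Nat.cast_add_one, Real.rpow_natCast]
  calc _ = D * (1 / s ^ ((N : ℝ) + α + 1)) := by
        rw [e, hD, Real.rpow_neg hs0.le, div_pow]
        have := Real.rpow_pos_of_pos hs0 α
        field_simp
    _ ≤ _ := by gcongr; exact le_max_right _ _

variable (N) in
/-- The growth of functions in `A_α^ψ`. -/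
theorem exists_norm_point_le {α : ℝ} (hα : -1 ≤ α) :
    ∃ C : ℝ, 1 ≤ C ∧ ∀ (ψ : ℝ → ℝ), IsOrlicz ψ → ∀ (f : Cn N → ℂ) (K : ℝ),
      DifferentiableOn ℂ f (unitBall N) → 0 < K → UnitModular N α ψ f K → ∀ a ∈ unitBall N,
      ‖f a‖ ≤ C * K * orliczInv ψ (1 / (1 - ‖a‖) ^ ((N : ℝ) + α + 1)) := by
  obtain ⟨C, hC1, hC⟩ := exists_modular_point_le N hα
  refine ⟨C, hC1, fun ψ hψ f K hf hK hmod a ha => ?_⟩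
  have ha1 : ‖a‖ < 1 := mem_ball_zero_iff.1 ha
  have h0 : 0 ≤ 1 / (1 - ‖a‖) ^ ((N : ℝ) + α + 1) := by
    have := Real.rpow_nonneg (show 0 ≤ 1 - ‖a‖ by linarith) ((N : ℝ) + α + 1)
    positivity
  have h1 := hC ψ hψ f K hf hK hmod a ha
  rw [← hψ.le_inv_iff (by positivity) (by positivity)] at h1
  have h2 := h1.trans (hψ.inv_mul_le hC1 h0)
  rw [div_le_iff₀ hK] at h2
  linarith

end BergmanOrlicz

namespace BergmanOrlicz

variable {N : ℕ} [NeZero N]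

/-! ### Test functions -/

/-- The kernel `(δ / (1 + δ - ⟨z, ξ⟩))^k`. -/
noncomputable def testKernel {N : ℕ} (ξ : Cn N) (δ : ℝ) (k : ℕ) (z : Cn N) : ℂ :=
  ((δ : ℂ) / (1 + δ - inner ℂ ξ z)) ^ k

omit [NeZero N] in
theorem le_re_one_add_sub_inner {ξ z : Cn N} (hξ : ‖ξ‖ = 1) (hz : ‖z‖ ≤ 1) (δ : ℝ) :
    δ ≤ (1 + δ - inner ℂ ξ z : ℂ).re := by
  have h1 := norm_inner_le_norm (𝕜 := ℂ) ξ z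
  have h2 := Complex.re_le_norm (inner ℂ ξ z)
  rw [hξ, one_mul] at h1
  simp only [Complex.sub_re, Complex.add_re, Complex.one_re, Complex.ofReal_re]
  linarith

omit [NeZero N] in
theorem one_add_sub_inner_ne_zero {ξ z : Cn N} (hξ : ‖ξ‖ = 1) (hz : ‖z‖ ≤ 1) {δ : ℝ} (hδ : 0 < δ) :
    (1 + δ - inner ℂ ξ z : ℂ) ≠ 0 := fun h => by
  have := le_re_one_add_sub_inner hξ hz δ
  rw [h, Complex.zero_re] at this
  linarith

omit [NeZero N] in
theorem differentiableAt_testKernel {ξ z : Cn N} (hξ : ‖ξ‖ = 1) (hz : ‖z‖ ≤ 1) {δ : ℝ} (hδ : 0 < δ)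
    (k : ℕ) : DifferentiableAt ℂ (testKernel ξ δ k) z := by
  have hi : DifferentiableAt ℂ (fun z : Cn N => inner ℂ ξ z) z :=
    (innerSL ℂ ξ).differentiableAt
  unfold testKernel
  have hd : DifferentiableAt ℂ (fun z : Cn N => (1 + δ - inner ℂ ξ z : ℂ)) z := hi.const_sub _
  have hne := one_add_sub_inner_ne_zero hξ hz hδ
  simp only [div_eq_mul_inv]
  exact ((hd.fun_inv hne).const_mul (δ : ℂ)).fun_pow k

omit [NeZero N] in
theorem norm_testKernel_base_le_one {ξ z : Cn N} (hξ : ‖ξ‖ = 1) (hz : ‖z‖ ≤ 1) {δ : ℝ} (hδ : 0 < δ) :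
    ‖(δ : ℂ) / (1 + δ - inner ℂ ξ z)‖ ≤ 1 := by
  rw [norm_div, Complex.norm_real, Real.norm_of_nonneg hδ.le]
  exact div_le_one_of_le₀ ((le_re_one_add_sub_inner hξ hz δ).trans (Complex.re_le_norm _))
    (norm_nonneg _)

-- The kernel is evaluated at `r•z`, the cap at `z`. Since `1-r ≤ |1-r⟨ξ,z⟩| ≤ |1+δ-r⟨ξ,z⟩|`, the
-- dilation costs only a factor `2`, uniformly in `r`, as the Hardy norm requires.
omit [NeZero N] in
theorem norm_testKernel_base_mul_le {ξ z : Cn N} (hξ : ‖ξ‖ = 1) (hz : ‖z‖ ≤ 1) {δ : ℝ} (hδ : 0 < δ)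
    {r : ℝ} (hr0 : 0 < r) (hr1 : r ≤ 1) :
    ‖(δ : ℂ) / (1 + δ - inner ℂ ξ (r • z))‖ * ‖1 - inner ℂ ξ z‖ ≤ 2 * δ := by
  have hrz : ‖r • z‖ ≤ r := by
    rw [norm_smul, Real.norm_of_nonneg hr0.le]; nlinarith [norm_nonneg z]
  have hne := one_add_sub_inner_ne_zero hξ (hrz.trans hr1) hδ
  set u := inner ℂ ξ z with hu
  have e : inner ℂ ξ (r • z) = (r : ℂ) * u := by
    rw [inner_smul_right_eq_smul, Complex.real_smul]
  have hu1 : ‖u‖ ≤ 1 := by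
    have := norm_inner_le_norm (𝕜 := ℂ) ξ z
    rw [hξ, one_mul] at this
    linarith
  have hre : u.re ≤ 1 := (Complex.re_le_norm u).trans hu1
  rw [e] at hne ⊢
  have hru : r * u.re ≤ r := by nlinarith
  have h1 : ‖1 - (r : ℂ) * u‖ ≤ ‖1 + δ - (r : ℂ) * u‖ := by
    rw [Complex.norm_eq_sqrt_sq_add_sq, Complex.norm_eq_sqrt_sq_add_sq]
    refine Real.sqrt_le_sqrt ?_
    simp only [Complex.sub_re, Complex.one_re, Complex.sub_im, Complex.one_im, Complex.add_re,
      Complex.add_im, Complex.ofReal_re, Complex.ofReal_im, Complex.re_ofReal_mul,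
      Complex.im_ofReal_mul]
    nlinarith
  have h2 : 1 - r ≤ ‖1 - (r : ℂ) * u‖ := by
    have := Complex.re_le_norm (1 - (r : ℂ) * u)
    simp only [Complex.sub_re, Complex.one_re, Complex.re_ofReal_mul] at this
    linarith
  have h3 : ‖1 - u‖ ≤ 2 * ‖1 + δ - (r : ℂ) * u‖ := by
    have e2 : 1 - u = (1 - (r : ℂ) * u) - ((1 - r : ℝ) : ℂ) * u := by push_cast; ring
    rw [e2]
    refine (norm_sub_le _ _).trans ?_
    rw [norm_mul, Complex.norm_real, Real.norm_of_nonneg (by linarith)]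
    nlinarith [norm_nonneg u]
  rw [norm_div, Complex.norm_real, Real.norm_of_nonneg hδ.le, div_mul_eq_mul_div,
    div_le_iff₀ (norm_pos_iff.2 hne)]
  nlinarith

/-- Take the first `j` with `X ≤ 2δ·2^j`. If `j ≥ 1`, failure at `j-1` gives `q ≤ 2^(1-j)`; if `j =
0`, the bound `q ≤ 1` suffices. With `X = |1-⟨ξ,z⟩|` this decomposes the kernel over dyadic caps. -/
theorem pow_le_tsum_dyadic {q X δ : ℝ} (hq0 : 0 ≤ q) (hq1 : q ≤ 1) (hδ : 0 < δ)
    (hqX : q * X ≤ 2 * δ) (k : ℕ) :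
    ENNReal.ofReal (q ^ k) ≤ ∑' j : ℕ, ENNReal.ofReal ((2 * 2⁻¹ ^ j) ^ k) *
      (Iic (2 * δ * 2 ^ j)).indicator 1 X := by
  classical
  have hex : ∃ j : ℕ, X ≤ 2 * δ * 2 ^ j := by
    obtain ⟨j, hj⟩ := pow_unbounded_of_one_lt (X / (2 * δ)) one_lt_two
    refine ⟨j, ?_⟩
    rw [div_lt_iff₀ (by positivity)] at hj
    linarith
  obtain ⟨j, hj, hmin⟩ : ∃ j : ℕ, X ≤ 2 * δ * 2 ^ j ∧ q ≤ 2 * 2⁻¹ ^ j := by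
    refine ⟨Nat.find hex, Nat.find_spec hex, ?_⟩
    rcases h : Nat.find hex with _ | i
    · simp; linarith
    · have h1 : 2 * δ * 2 ^ i < X := not_le.1 (Nat.find_min hex (m := i) (by omega))
      have h2 : q * 2 ^ i ≤ 1 := by
        have : q * (2 * δ * 2 ^ i) ≤ 2 * δ := (mul_le_mul_of_nonneg_left h1.le hq0).trans hqX
        have h3 : q * 2 ^ i * (2 * δ) ≤ 1 * (2 * δ) := by linarith
        exact le_of_mul_le_mul_right h3 (by positivity)
      rw [pow_succ, inv_pow]
      calc q ≤ (2 ^ i)⁻¹ := by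
            rw [← one_div, le_div_iff₀ (by positivity)]; exact h2
        _ = _ := by ring
  refine le_trans ?_ (ENNReal.le_tsum j)
  rw [indicator_of_mem (mem_Iic.2 hj), Pi.one_apply, mul_one]
  gcongr

-- The dyadic caps contribute terms of order `2^(-jk) (δ·2^j)^p`; the condition on `k` says `k ≥
-- p+1`, so the sum is dominated by a geometric series of ratio `1/2`.
variable (N) in
theorem exists_lintegral_testKernel_le {α : ℝ} (hα : -1 ≤ α) {k : ℕ} (hk : (N : ℝ) + α + 2 ≤ k) :
    ∃ C : ℝ, 0 < C ∧ ∀ (ξ : Cn N) (δ r : ℝ), ‖ξ‖ = 1 → 0 < δ → 0 < r → r ≤ 1 →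
      ∫⁻ z, ENNReal.ofReal ‖testKernel ξ δ k (r • z)‖ ∂vMeasure N α ≤
        ENNReal.ofReal (C * δ ^ ((N : ℝ) + α + 1)) := by
  obtain ⟨c, hct, hc⟩ := exists_vMeasure_cap_le N hα
  set p := (N : ℝ) + α + 1 with hp
  set D : ℝ≥0∞ := c * ENNReal.ofReal (2 ^ k * 2 ^ p) * 2 with hD
  have hDt : D ≠ ∞ := ENNReal.mul_ne_top (ENNReal.mul_ne_top hct ENNReal.ofReal_ne_top) (by simp)
  refine ⟨D.toReal + 1, by positivity, fun ξ δ r hξ hδ hr0 hr1 => ?_⟩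
  calc _ ≤ ∫⁻ z, ∑' j : ℕ, ENNReal.ofReal ((2 * 2⁻¹ ^ j) ^ k) *
          (cap ξ (2 * δ * 2 ^ j)).indicator 1 z ∂vMeasure N α := by
        refine lintegral_mono_ae ?_
        filter_upwards [ae_vMeasure_norm_le_one α] with z hz
        have hrz : ‖r • z‖ ≤ 1 := by
          rw [norm_smul, Real.norm_of_nonneg hr0.le]; nlinarith [norm_nonneg z]
        rw [testKernel, norm_pow]
        exact pow_le_tsum_dyadic (norm_nonneg _) (norm_testKernel_base_le_one hξ hrz hδ) hδ
          (norm_testKernel_base_mul_le hξ hz hδ hr0 hr1) k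
    _ = ∑' j : ℕ, ENNReal.ofReal ((2 * 2⁻¹ ^ j) ^ k) * vMeasure N α (cap ξ (2 * δ * 2 ^ j)) := by
        rw [lintegral_tsum fun j => ((measurable_one.indicator
          (measurableSet_cap _ _)).const_mul _).aemeasurable]
        refine tsum_congr fun j => ?_
        rw [lintegral_const_mul _ (measurable_one.indicator (measurableSet_cap _ _)),
          lintegral_indicator_one (measurableSet_cap _ _)]
    _ ≤ ∑' j : ℕ, c * ENNReal.ofReal (2 ^ k * 2 ^ p) * ENNReal.ofReal (δ ^ p) * 2⁻¹ ^ j := by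
        refine ENNReal.tsum_le_tsum fun j => ?_
        refine (mul_le_mul_right (hc ξ _ hξ (by positivity)) _).trans ?_
        have h2 : (2⁻¹ : ℝ≥0∞) ^ j = ENNReal.ofReal (2⁻¹ ^ j) := by
          rw [ENNReal.ofReal_pow (by positivity), ENNReal.ofReal_inv_of_pos two_pos]; simp
        rw [h2, mul_left_comm, mul_assoc, mul_assoc c, mul_assoc c]
        refine mul_le_mul_right ?_ c
        rw [← ENNReal.ofReal_mul (by positivity), ← ENNReal.ofReal_mul (by positivity),
          ← ENNReal.ofReal_mul (by positivity)]
        refine ENNReal.ofReal_le_ofReal ?_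
        rw [Real.mul_rpow (by positivity) (by positivity), Real.mul_rpow hδ.le (by positivity),
          mul_pow]
        have h3 : ((2⁻¹ : ℝ) ^ j) ^ k * ((2 : ℝ) ^ j) ^ p ≤ 2⁻¹ ^ j := by
          have hy : (1 : ℝ) ≤ 2 ^ j := one_le_pow₀ one_le_two
          have hy0 : (0 : ℝ) < 2 ^ j := by positivity
          rw [inv_pow, inv_pow, inv_mul_le_iff₀ (by positivity), ← div_eq_mul_inv,
            le_div_iff₀ hy0, ← Real.rpow_add_one hy0.ne', ← Real.rpow_natCast _ k]
          exact Real.rpow_le_rpow_of_exponent_le hy (by linarith)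
        calc _ = 2 ^ k * 2 ^ p * δ ^ p * (((2⁻¹ : ℝ) ^ j) ^ k * ((2 : ℝ) ^ j) ^ p) := by ring
          _ ≤ 2 ^ k * 2 ^ p * δ ^ p * 2⁻¹ ^ j := by gcongr
          _ = _ := by ring
    _ = D * ENNReal.ofReal (δ ^ p) := by
        rw [ENNReal.tsum_mul_left, ENNReal.tsum_geometric, ENNReal.one_sub_inv_two, inv_inv]
        ring
    _ ≤ _ := by
        rw [← ENNReal.ofReal_toReal hDt, ← ENNReal.ofReal_mul ENNReal.toReal_nonneg]
        gcongr
        rw [ENNReal.ofReal_toReal hDt]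
        linarith

variable (N) in
/-- Functions in the unit ball of `A_α^ψ` of maximal growth towards a point of the sphere. -/
theorem exists_unitModular_testKernel {α : ℝ} (hα : -1 ≤ α) :
    ∃ (k : ℕ) (c : ℝ), 0 < c ∧ ∀ (ψ : ℝ → ℝ), IsOrlicz ψ → ∀ (ξ : Cn N) (δ : ℝ), ‖ξ‖ = 1 → 0 < δ →
      UnitModular N α ψ (fun z =>
        ((c * orliczInv ψ (1 / δ ^ ((N : ℝ) + α + 1)) : ℝ) : ℂ) * testKernel ξ δ k z) 1 := by
  obtain ⟨k, hk⟩ := exists_nat_ge ((N : ℝ) + α + 2)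
  obtain ⟨C, hC0, hC⟩ := exists_lintegral_testKernel_le N hα hk
  set p := (N : ℝ) + α + 1 with hp
  -- The bound `1` keeps the factor in front of `M` at most `1`, as convexity requires; the bound
  -- `C⁻¹` cancels the constant of the kernel integral.
  refine ⟨k, min 1 C⁻¹, by positivity, fun ψ hψ ξ δ hξ hδ => ?_⟩
  set c := min 1 C⁻¹ with hc
  have hc0 : 0 < c := by positivity
  set M := orliczInv ψ (1 / δ ^ p) with hM
  have hM0 : 0 ≤ M := hψ.inv_nonneg (by positivity)
  have main : ∀ r : ℝ, 0 < r → r ≤ 1 → modular ψ (vMeasure N α)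
      (fun z => ((c * M : ℝ) : ℂ) * testKernel ξ δ k (r • z)) 1 ≤ 1 := by
    intro r hr0 hr1
    calc _ ≤ ∫⁻ z, ENNReal.ofReal (c * (1 / δ ^ p)) * ENNReal.ofReal ‖testKernel ξ δ k (r • z)‖
          ∂vMeasure N α := by
          refine lintegral_mono_ae ?_
          filter_upwards [ae_vMeasure_norm_le_one α] with z hz
          have hrz : ‖r • z‖ ≤ 1 := by
            rw [norm_smul, Real.norm_of_nonneg hr0.le]; nlinarith [norm_nonneg z]
          have hT : ‖testKernel ξ δ k (r • z)‖ ≤ 1 := by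
            rw [testKernel, norm_pow]
            exact pow_le_one₀ (norm_nonneg _) (norm_testKernel_base_le_one hξ hrz hδ)
          rw [← ENNReal.ofReal_mul (by positivity)]
          refine ENNReal.ofReal_le_ofReal ?_
          rw [div_one, norm_mul, Complex.norm_real, Real.norm_of_nonneg (by positivity)]
          -- Convexity linearizes the modular: `ψ(tM) ≤ tψ(M) = t/δ^p`. Only the `L¹` norm of the
          -- kernel remains.
          have h1 := hψ.map_mul_le (t := c * ‖testKernel ξ δ k (r • z)‖) (by positivity)
            (mul_le_one₀ (min_le_left _ _) (norm_nonneg _) hT) hM0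
          rw [hM, hψ.map_inv (by positivity), ← hM] at h1
          calc _ = ψ (c * ‖testKernel ξ δ k (r • z)‖ * M) := by ring_nf
            _ ≤ _ := h1
            _ = _ := by ring
      _ ≤ ENNReal.ofReal (c * (1 / δ ^ p)) * ENNReal.ofReal (C * δ ^ p) := by
          rw [lintegral_const_mul' _ _ ENNReal.ofReal_ne_top]
          gcongr
          exact hC ξ δ r hξ hδ hr0 hr1
      _ ≤ 1 := by
          rw [← ENNReal.ofReal_mul (by positivity), ENNReal.ofReal_le_one]
          have hδp : 0 < δ ^ p := by positivity
          calc _ = c * C := by field_simp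
            _ ≤ C⁻¹ * C := by gcongr; exact min_le_right _ _
            _ = 1 := inv_mul_cancel₀ hC0.ne'
  unfold UnitModular
  split_ifs with h
  · subst h
    exact fun r hr => main r hr.1 hr.2.le
  · simpa using main 1 one_pos le_rfl

end BergmanOrlicz

namespace BergmanOrlicz

variable {N : ℕ}

/-! ### Radial limits and the boundary map -/

theorem hasValue_neg_one {F : Type*} [TopologicalSpace F] {g : Cn N → F} {z : Cn N} {w : F} :
    HasValue (-1) g z w ↔ Tendsto (fun r : ℝ => g (r • z)) (𝓝[<] 1) (𝓝 w) := by
  rw [HasValue, if_pos rfl]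

theorem hasValue_of_ne {F : Type*} [TopologicalSpace F] {α : ℝ} (hα : α ≠ -1) {g : Cn N → F}
    {z : Cn N} {w : F} : HasValue α g z w ↔ g z = w := by
  rw [HasValue, if_neg hα]

theorem HasValue.comp {α : ℝ} {φ : Cn N → Cn N} {f : Cn N → ℂ} {z w : Cn N}
    (h : HasValue α φ z w) (hf : ContinuousAt f w) : HasValue α (f ∘ φ) z (f w) := by
  unfold HasValue at h ⊢
  split_ifs at h ⊢
  · exact hf.tendsto.comp h
  · rw [Function.comp_apply, h]

theorem HasValue.unique {F : Type*} [TopologicalSpace F] [T2Space F] {α : ℝ} {g : Cn N → F}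
    {z : Cn N} {w w' : F} (h : HasValue α g z w) (h' : HasValue α g z w') : w = w' := by
  unfold HasValue at h h'
  split_ifs at h h'
  · exact tendsto_nhds_unique h h'
  · rw [← h, ← h']

theorem smul_mem_unitBall {ζ : Cn N} (hζ : ‖ζ‖ ≤ 1) {r : ℝ} (hr : r ∈ Ioo (0 : ℝ) 1) :
    r • ζ ∈ unitBall N := by
  rw [unitBall, mem_ball_zero_iff, norm_smul, Real.norm_of_nonneg hr.1.le]
  exact (mul_le_of_le_one_right hr.1.le hζ).trans_lt hr.2

theorem complex_smul_mem_unitBall {ζ : Cn N} (hζ : ‖ζ‖ ≤ 1) {c : ℂ} (hc : ‖c‖ < 1) :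
    c • ζ ∈ unitBall N := by
  rw [unitBall, mem_ball_zero_iff, norm_smul]
  exact (mul_le_of_le_one_right (norm_nonneg c) hζ).trans_lt hc

/-- The points of the sphere at which `F` is radially Cauchy. -/
def radiallyCauchy (F : Cn N → ℂ) : Set (Cn N) :=
  ⋂ k : ℕ, ⋃ m : ℕ, ⋂ r ∈ Ioo (1 - 1 / ((m : ℝ) + 1)) 1 ∩ Ioo 0 1,
    ⋂ s ∈ Ioo (1 - 1 / ((m : ℝ) + 1)) 1 ∩ Ioo 0 1,
      {ζ | ζ ∈ Metric.sphere (0 : Cn N) 1 ∧ dist (F (r • ζ)) (F (s • ζ)) ≤ 1 / ((k : ℝ) + 1)}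

theorem continuousOn_dilate {E : Type*} [TopologicalSpace E] {F : Cn N → E}
    (hF : ContinuousOn F (unitBall N)) {r : ℝ}
    (hr : r ∈ Ioo (0 : ℝ) 1) : ContinuousOn (fun ζ => F (r • ζ)) (Metric.closedBall (0 : Cn N) 1) :=
  hF.comp (by fun_prop) fun _ hζ => smul_mem_unitBall (mem_closedBall_zero_iff.1 hζ) hr

/-- The uncountable intersections over `r` and `s` are intersections of closed sets; only the
countable operations over `k` and `m` remain. Measurability is what permits Fubini below. -/
theorem measurableSet_radiallyCauchy {F : Cn N → ℂ} (hF : ContinuousOn F (unitBall N)) :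
    MeasurableSet (radiallyCauchy F) := by
  refine MeasurableSet.iInter fun k => MeasurableSet.iUnion fun m => IsClosed.measurableSet ?_
  refine isClosed_biInter fun r hr => isClosed_biInter fun s hs => ?_
  have hc : ContinuousOn (fun ζ => dist (F (r • ζ)) (F (s • ζ))) (Metric.sphere (0 : Cn N) 1) :=
    (continuous_dist.comp_continuousOn ((continuousOn_dilate hF hr.2).prodMk
      (continuousOn_dilate hF hs.2))).mono Metric.sphere_subset_closedBall
  exact hc.preimage_isClosed_of_isClosed Metric.isClosed_sphere isClosed_Iic

theorem mem_radiallyCauchy_of_tendsto {F : Cn N → ℂ} {ζ : Cn N} (hζ : ‖ζ‖ = 1) {c : ℂ}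
    (h : Tendsto (fun r : ℝ => F (r • ζ)) (𝓝[<] 1) (𝓝 c)) : ζ ∈ radiallyCauchy F := by
  refine mem_iInter.2 fun k => mem_iUnion.2 ?_
  rw [Metric.tendsto_nhdsWithin_nhds] at h
  obtain ⟨δ, hδ, hd⟩ := h (1 / ((k : ℝ) + 1) / 2) (by positivity)
  obtain ⟨m, hm⟩ := exists_nat_one_div_lt hδ
  have hclose : ∀ r ∈ Ioo (1 - 1 / ((m : ℝ) + 1)) 1, dist (F (r • ζ)) c < 1 / ((k : ℝ) + 1) / 2 :=
    fun r hr => hd (mem_Iio.2 hr.2) (by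
      rw [Real.dist_eq, abs_of_neg (by linarith [hr.2])]
      linarith [hr.1])
  refine ⟨m, mem_iInter₂.2 fun r hr => mem_iInter₂.2 fun s hs => ⟨by simpa using hζ, ?_⟩⟩
  have h1 := hclose r hr.1
  have h2 := hclose s hs.1
  linarith [dist_triangle_right (F (r • ζ)) (F (s • ζ)) c]

theorem exists_tendsto_of_mem_radiallyCauchy {F : Cn N → ℂ} {ζ : Cn N}
    (h : ζ ∈ radiallyCauchy F) : ∃ c, Tendsto (fun r : ℝ => F (r • ζ)) (𝓝[<] 1) (𝓝 c) := by
  rw [← cauchy_map_iff_exists_tendsto, Metric.cauchy_iff]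
  refine ⟨inferInstance, fun ε hε => ?_⟩
  obtain ⟨k, hk⟩ := exists_nat_one_div_lt hε
  obtain ⟨m, hm⟩ := mem_iUnion.1 (mem_iInter.1 h k)
  have hm0 : (0 : ℝ) < 1 / ((m : ℝ) + 1) := by positivity
  refine ⟨_, image_mem_map (inter_mem (Ioo_mem_nhdsLT (show 1 - 1 / ((m : ℝ) + 1) < 1 by linarith))
    (Ioo_mem_nhdsLT one_pos)), ?_⟩
  rintro _ ⟨r, hr, rfl⟩ _ ⟨s, hs, rfl⟩
  exact (mem_iInter₂.1 (mem_iInter₂.1 hm r hr) s hs).2.trans_lt hk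

/-- By rotation invariance, the measure of the exceptional set equals its average over rotations `ζ
↦ e^{iθ}ζ`. After Fubini, the inner integral vanishes by the one-variable Fatou theorem on the slice
through `ζ`. -/
theorem ae_exists_radial_limit {F : Cn N → ℂ} (hF : DifferentiableOn ℂ F (unitBall N)) {M : ℝ}
    (hM : ∀ z ∈ unitBall N, ‖F z‖ ≤ M) :
    ∀ᵐ ζ ∂surfaceMeasure N, ∃ c, Tendsto (fun r : ℝ => F (r • ζ)) (𝓝[<] 1) (𝓝 c) := by
  have hmeas := (measurableSet_radiallyCauchy hF.continuousOn).compl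
  suffices h : surfaceMeasure N (radiallyCauchy F)ᶜ = 0 by
    filter_upwards [compl_mem_ae_iff.2 h] with ζ hζ
    exact exists_tendsto_of_mem_radiallyCauchy (not_not.1 hζ)
  set e : ℝ → ℂ := fun θ => Complex.exp (θ * Complex.I) with he
  have he1 : ∀ θ, ‖e θ‖ = 1 := Complex.norm_exp_ofReal_mul_I
  set ν : Measure ℝ := volume.restrict (Icc 0 1) with hν
  have hind : Measurable ((radiallyCauchy F)ᶜ.indicator (1 : Cn N → ℝ≥0∞)) :=
    measurable_one.indicator hmeas
  calc surfaceMeasure N (radiallyCauchy F)ᶜ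
      = ∫⁻ θ, (∫⁻ ζ, (radiallyCauchy F)ᶜ.indicator 1 (e θ • ζ) ∂surfaceMeasure N) ∂ν := by
        simp only [lintegral_surfaceMeasure_rotate hind (he1 _), lintegral_indicator_one hmeas]
        simp [hν]
    _ = ∫⁻ ζ, (∫⁻ θ, (radiallyCauchy F)ᶜ.indicator 1 (e θ • ζ) ∂ν) ∂surfaceMeasure N :=
        lintegral_lintegral_swap (hind.comp (by fun_prop)).aemeasurable
    _ = 0 := by
        refine lintegral_eq_zero_of_ae_eq_zero ?_
        filter_upwards [ae_norm_eq_one N] with ζ hζ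
        refine lintegral_eq_zero_of_ae_eq_zero (ae_restrict_of_ae ?_)
        have hd : DifferentiableOn ℂ (fun c : ℂ => F (c • ζ)) (Metric.ball 0 1) := by
          have := differentiableOn_slice hF 0 ζ (S := Metric.ball 0 1) fun c hc => by
            rw [zero_add]
            exact complex_smul_mem_unitBall hζ.le (mem_ball_zero_iff.1 hc)
          simpa only [zero_add] using this
        filter_upwards [ae_exists_tendsto_radial hd (M := M) fun c hc =>
          hM _ (complex_smul_mem_unitBall hζ.le (mem_ball_zero_iff.1 hc))] with θ hθ
        obtain ⟨c, hc⟩ := hθ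
        rw [Pi.zero_apply, indicator_of_notMem]
        rw [mem_compl_iff, not_not]
        refine mem_radiallyCauchy_of_tendsto (c := c) (by rw [norm_smul, he1, hζ, one_mul])
          (hc.congr fun r => ?_)
        rw [mul_smul, Complex.coe_smul]

theorem aestronglyMeasurable_of_continuousOn_closedBall {E : Type*} [TopologicalSpace E]
    [TopologicalSpace.PseudoMetrizableSpace E] {α : ℝ} {g : Cn N → E}
    (hg : ContinuousOn g (Metric.closedBall (0 : Cn N) 1)) :
    AEStronglyMeasurable g (vMeasure N α) := by
  have h : (vMeasure N α).restrict (Metric.closedBall (0 : Cn N) 1) = vMeasure N α :=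
    Measure.restrict_eq_self_of_ae_mem ((ae_vMeasure_norm_le_one α).mono fun z hz =>
      mem_closedBall_zero_iff.2 hz)
  rw [← h]
  exact hg.aestronglyMeasurable Metric.isClosed_closedBall.measurableSet

/-- The sequence `1 - 1 / (n + 2)`. -/
noncomputable def radius (n : ℕ) : ℝ := 1 - 1 / ((n : ℝ) + 2)

theorem radius_mem (n : ℕ) : radius n ∈ Ioo (0 : ℝ) 1 := by
  have h : (1 : ℝ) / ((n : ℝ) + 2) < 1 := by
    rw [div_lt_one (by positivity)]; linarith [(Nat.cast_nonneg n : (0 : ℝ) ≤ n)]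
  have h2 : (0 : ℝ) < 1 / ((n : ℝ) + 2) := by positivity
  unfold radius
  constructor <;> linarith

theorem tendsto_radius : Tendsto radius atTop (𝓝[<] 1) := by
  refine tendsto_nhdsWithin_iff.2 ⟨?_, Eventually.of_forall fun n => (radius_mem n).2⟩
  have h := (tendsto_const_div_atTop_nhds_zero_nat (1 : ℝ)).comp (tendsto_add_atTop_nat 2)
  have h2 := h.const_sub 1
  rw [sub_zero] at h2
  refine h2.congr fun n => ?_
  simp [radius]

/-- In the Hardy case limits exist coordinate by coordinate, and the limit along the sequence
`radius` supplies a measurable representative. Only `‖b z‖ ≤ 1` is available there: radial limits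
may lie on the sphere. -/
theorem exists_boundary_map {α : ℝ} {φ : Cn N → Cn N}
    (hφ : DifferentiableOn ℂ φ (unitBall N)) (hmaps : MapsTo φ (unitBall N) (unitBall N)) :
    ∃ b : Cn N → Cn N, Measurable b ∧ ∀ᵐ z ∂vMeasure N α,
      HasValue α φ z (b z) ∧ ‖b z‖ ≤ 1 ∧ (α ≠ -1 → ‖b z‖ < 1) := by
  by_cases hα : α = -1
  · subst hα
    have hcoord : ∀ᵐ ζ ∂vMeasure N (-1), ∀ i : Fin N,
        ∃ c, Tendsto (fun r : ℝ => φ (r • ζ) i) (𝓝[<] 1) (𝓝 c) := by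
      rw [ae_all_iff]
      intro i
      rw [vMeasure_neg_one]
      refine Measure.smul_absolutelyContinuous.ae_le (ae_exists_radial_limit (M := 1)
        (F := fun z => φ z i) ?_ fun z hz => ?_)
      · exact (EuclideanSpace.proj (𝕜 := ℂ) i).differentiable.comp_differentiableOn hφ
      · exact (PiLp.norm_apply_le (φ z) i).trans (mem_ball_zero_iff.1 (hmaps hz)).le
    have hlim : ∀ᵐ ζ ∂vMeasure N (-1), ∃ w, Tendsto (fun r : ℝ => φ (r • ζ)) (𝓝[<] 1) (𝓝 w) := by
      filter_upwards [hcoord] with ζ hζ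
      choose c hc using hζ
      have h1 : Tendsto (fun r : ℝ => WithLp.ofLp (φ (r • ζ))) (𝓝[<] 1) (𝓝 c) :=
        tendsto_pi_nhds.2 hc
      exact ⟨WithLp.toLp 2 c, ((PiLp.continuous_toLp 2 _).tendsto c).comp h1⟩
    obtain ⟨b, hb, hbl⟩ := exists_stronglyMeasurable_limit_of_tendsto_ae (μ := vMeasure N (-1))
      (f := fun n ζ => φ (radius n • ζ))
      (fun n => aestronglyMeasurable_of_continuousOn_closedBall
        (continuousOn_dilate hφ.continuousOn (radius_mem n)))
      (hlim.mono fun ζ ⟨w, hw⟩ => ⟨w, hw.comp tendsto_radius⟩)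
    refine ⟨b, hb.measurable, ?_⟩
    filter_upwards [hlim, hbl, ae_vMeasure_norm_le_one (-1)] with ζ ⟨w, hw⟩ hζ hn
    have hwb : w = b ζ := tendsto_nhds_unique (hw.comp tendsto_radius) hζ
    refine ⟨hasValue_neg_one.2 (hwb ▸ hw), ?_, fun h => absurd rfl h⟩
    exact le_of_tendsto hζ.norm (Eventually.of_forall fun n =>
      (mem_ball_zero_iff.1 (hmaps (smul_mem_unitBall hn (radius_mem n)))).le)
  · have hm : AEStronglyMeasurable φ (vMeasure N α) := by
      have h : (vMeasure N α).restrict (unitBall N) = vMeasure N α :=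
        Measure.restrict_eq_self_of_ae_mem (ae_vMeasure_norm_lt_one hα)
      rw [← h]
      exact hφ.continuousOn.aestronglyMeasurable Metric.isOpen_ball.measurableSet
    refine ⟨hm.mk φ, hm.stronglyMeasurable_mk.measurable, ?_⟩
    filter_upwards [hm.ae_eq_mk, ae_vMeasure_norm_lt_one hα] with z hz hzB
    have h1 : ‖φ z‖ < 1 := mem_ball_zero_iff.1 (hmaps hzB)
    rw [← hz]
    exact ⟨(hasValue_of_ne hα).2 rfl, h1.le, fun _ => h1⟩

/-! ### Necessity -/

theorem mem_corona_iff {α h : ℝ} {w : Cn N} : w ∈ corona N α h ↔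
    ‖w‖ ≤ 1 ∧ (α ≠ -1 → ‖w‖ < 1) ∧ 1 - ‖w‖ < h := by
  unfold corona
  split_ifs with hα
  · simp [hα]
  · simp only [mem_ofPred_eq, unitBall, mem_ball_zero_iff]
    exact ⟨fun h => ⟨h.1.le, fun _ => h.1, h.2⟩, fun h => ⟨h.2.1 hα, h.2.2⟩⟩

/-- If `φ*(z) = w` is in the corona of width `h`, a test function peaking near `w/|w|` at scale
about `h` has size comparable to `ψ⁻¹(1/h^p)` at `w`, and `y z` dominates it. -/
theorem exists_ae_le_of_orderBounded [NeZero N] {α : ℝ} (hα : -1 ≤ α) {ψ : ℝ → ℝ} (hψ : IsOrlicz ψ)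
    {φ : Cn N → Cn N} {y : Cn N → ℝ}
    (hy : ∀ f : Cn N → ℂ, MemSpace N α ψ f → spaceNorm N α ψ f ≤ 1 →
      ∀ᵐ z ∂(vMeasure N α), ∃ w : ℂ, HasValue α (f ∘ φ) z w ∧ ‖w‖ ≤ y z) :
    ∃ c : ℝ, 0 < c ∧ ∀ᵐ z ∂(vMeasure N α), ∀ h ∈ Ioo (0 : ℝ) 1,
      (∃ w ∈ corona N α h, HasValue α φ z w) →
      c * orliczInv ψ (1 / h ^ ((N : ℝ) + α + 1)) ≤ y z := by
  obtain ⟨k, c, hc, hT⟩ := exists_unitModular_testKernel N hα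
  set p := (N : ℝ) + α + 1 with hp
  have hp0 : 0 < p := by
    have : (1 : ℝ) ≤ N := by exact_mod_cast NeZero.one_le
    linarith
  -- Each test function has its own exceptional null set, so the directions are restricted to a
  -- countable dense set and the scales to positive rationals.
  obtain ⟨D, hDc, hDd⟩ := TopologicalSpace.exists_countable_dense (Metric.sphere (0 : Cn N) 1)
  have := hDc.to_subtype
  set T : Cn N → ℝ → Cn N → ℂ := fun ξ δ z =>
    ((c * orliczInv ψ (1 / δ ^ p) : ℝ) : ℂ) * testKernel ξ δ k z with hTdef
  have hall : ∀ᵐ z ∂(vMeasure N α), ∀ (ξ : D) (q : ℚ), 0 < q →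
      ∃ w : ℂ, HasValue α (T ξ q ∘ φ) z w ∧ ‖w‖ ≤ y z := by
    rw [ae_all_iff]
    intro ξ
    rw [ae_all_iff]
    intro q
    by_cases hq : 0 < q
    swap
    · exact Eventually.of_forall fun z h => absurd h hq
    have hξ : ‖((ξ : Metric.sphere (0 : Cn N) 1) : Cn N)‖ = 1 := by simp
    have hq' : (0 : ℝ) < q := by exact_mod_cast hq
    have hnorm := spaceNorm_le_of_unitModular one_pos (hT ψ hψ ξ q hξ hq')
    rw [ENNReal.ofReal_one] at hnorm
    have hmem : MemSpace N α ψ (T ξ q) := ⟨fun z hz =>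
      ((differentiableAt_testKernel hξ (mem_ball_zero_iff.1 hz).le hq' k).const_mul
        _).differentiableWithinAt, hnorm.trans_lt ENNReal.one_lt_top⟩
    filter_upwards [hy _ hmem hnorm] with z hz _ using hz
  -- The base of the kernel has numerator at least `h/2` and denominator at most `3h`.
  refine ⟨c * 6⁻¹ ^ k, by positivity, ?_⟩
  filter_upwards [hall] with z hz h hh ⟨w, hw, hval⟩
  obtain ⟨hw1, -, hwh⟩ := mem_corona_iff.1 hw
  have hw0 : 0 < ‖w‖ := by linarith [hh.2]
  set w₀ : Metric.sphere (0 : Cn N) 1 := ⟨(‖w‖ : ℂ)⁻¹ • w, by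
    simp [norm_smul, norm_pos_iff.1 hw0]⟩ with hw₀
  obtain ⟨ξ, hξD, hξw⟩ := hDd.exists_dist_lt w₀ hh.1
  -- `q < h` makes `ψ⁻¹(1/q^p)` at least `ψ⁻¹(1/h^p)`; `q > h/2` keeps the kernel bounded below.
  obtain ⟨q, hq1, hq2⟩ := exists_rat_btwn (half_lt_self hh.1)
  have hq0 : (0 : ℝ) < q := (half_pos hh.1).trans hq1
  have hξ1 : ‖(ξ : Cn N)‖ = 1 := by simp
  obtain ⟨v, hv, hvy⟩ := hz ⟨ξ, hξD⟩ q (by exact_mod_cast hq0)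
  have hcont : ContinuousAt (T ξ q) w :=
    ((differentiableAt_testKernel hξ1 hw1 hq0 k).const_mul _).continuousAt
  have hvT : v = T ξ q w := hv.unique (hval.comp hcont)
  refine le_trans ?_ (hvT ▸ hvy)
  have hinner : ‖1 - inner ℂ (ξ : Cn N) w‖ ≤ 2 * h := by
    have e : 1 - inner ℂ (ξ : Cn N) w =
        inner ℂ ((w₀ : Cn N) - ξ) w + ((1 - ‖w‖ : ℝ) : ℂ) := by
      have e1 : inner ℂ (w₀ : Cn N) w = (‖w‖ : ℂ) := by
        have hne : (‖w‖ : ℂ) ≠ 0 := by exact_mod_cast hw0.ne'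
        simp only [hw₀, inner_smul_left, inner_self_eq_norm_sq_to_K, map_inv₀, Complex.conj_ofReal]
        field_simp
        simp
      rw [inner_sub_left, e1]; push_cast; ring
    rw [e]
    refine (norm_add_le _ _).trans ?_
    rw [Complex.norm_real, Real.norm_of_nonneg (by linarith)]
    have h1 := norm_inner_le_norm (𝕜 := ℂ) ((w₀ : Cn N) - ξ) w
    have h2 : ‖(w₀ : Cn N) - ξ‖ < h := by
      rw [← dist_eq_norm]; exact hξw
    nlinarith [norm_nonneg ((w₀ : Cn N) - ξ)]
  have hbase : 6⁻¹ ≤ ‖((q : ℝ) : ℂ) / (1 + (q : ℝ) - inner ℂ (ξ : Cn N) w)‖ := by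
    rw [norm_div, Complex.norm_real, Real.norm_of_nonneg hq0.le,
      le_div_iff₀ (norm_pos_iff.2 (one_add_sub_inner_ne_zero hξ1 hw1 hq0))]
    have h3 : ‖1 + ((q : ℝ) : ℂ) - inner ℂ (ξ : Cn N) w‖ ≤ 3 * h := by
      rw [add_sub_right_comm]
      refine (norm_add_le _ _).trans ?_
      rw [Complex.norm_real, Real.norm_of_nonneg hq0.le]
      linarith
    linarith
  have hM : orliczInv ψ (1 / h ^ p) ≤ orliczInv ψ (1 / (q : ℝ) ^ p) := by
    have hh0 := hh.1
    refine hψ.inv_mono (by positivity) ?_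
    gcongr
  have hM0 : 0 ≤ orliczInv ψ (1 / (q : ℝ) ^ p) := hψ.inv_nonneg (by positivity)
  rw [hTdef]
  simp only
  rw [norm_mul, Complex.norm_real, Real.norm_of_nonneg (by positivity), testKernel, norm_pow]
  calc _ = c * orliczInv ψ (1 / h ^ p) * 6⁻¹ ^ k := by ring
    _ ≤ _ := by gcongr

/-- Order boundedness controls the pull-back measure of coronas by the modular of a majorant. -/
theorem exists_pullback_corona_le [NeZero N] {α : ℝ} (hα : -1 ≤ α) {ψ : ℝ → ℝ} (hψ : IsOrlicz ψ)
    {φ : Cn N → Cn N} {y : Cn N → ℝ} (hym : AEStronglyMeasurable y (vMeasure N α))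
    (hy : ∀ f : Cn N → ℂ, MemSpace N α ψ f → spaceNorm N α ψ f ≤ 1 →
      ∀ᵐ z ∂(vMeasure N α), ∃ w : ℂ, HasValue α (f ∘ φ) z w ∧ ‖w‖ ≤ y z) :
    ∃ c : ℝ, 0 < c ∧ ∀ A > 0, ∀ h ∈ Ioo (0 : ℝ) 1,
      pullback N α φ (corona N α h) ≤
        modular ψ (vMeasure N α) y (c / A) * ENNReal.ofReal (decay N α ψ A h) := by
  obtain ⟨c, hc, hae⟩ := exists_ae_le_of_orderBounded hα hψ hy
  refine ⟨c, hc, fun A hA h hh => ?_⟩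
  have hh0 := hh.1
  have hpos : 0 < orliczInv ψ (1 / h ^ ((N : ℝ) + α + 1)) := hψ.inv_pos (by positivity)
  have h1 : pullback N α φ (corona N α h) ≤
      vMeasure N α {z | c * orliczInv ψ (1 / h ^ ((N : ℝ) + α + 1)) ≤ ‖y z‖} := by
    refine measure_mono_ae ?_
    filter_upwards [hae] with z hz hzw
    exact (hz h hh hzw).trans (le_abs_self _)
  -- Markov at the constant `c/A`, which turns the level `c ψ⁻¹(1/h^p)` into `A ψ⁻¹(1/h^p)` inside
  -- `ψ`.
  refine h1.trans ((measure_le_norm_le_modular hψ hym (C := c / A) (by positivity)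
    (by positivity)).trans (le_of_eq ?_))
  rw [decay]
  congr 4
  field_simp

end BergmanOrlicz

namespace BergmanOrlicz

/-! ### Integrability from the `Δ¹`-condition -/

/-- On `t < X ≤ 2t` the integrand is at most `ψ(2εt) ≤ ψ(At/C₀)`, where the `2` in the condition on
`ε` pays for the dyadic step. Multiplied by the tail bound, `Δ¹` leaves `DC₀/(At)`, summable over
dyadic `t`. -/
theorem lintegral_lt_top_of_deltaUpOne {Ω : Type*} [MeasurableSpace Ω] {μ : Measure Ω}
    [IsFiniteMeasure μ] {ψ : ℝ → ℝ} (hψ : IsOrlicz ψ) {C₀ : ℝ} (hC₀ : 0 < C₀)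
    (hΔ : ∀ᶠ x : ℝ in atTop, x * ψ x ≤ ψ (C₀ * x)) {X : Ω → ℝ} (hX : Measurable X)
    (hX0 : ∀ x, 0 ≤ X x) {A D : ℝ} (hA : 0 < A) (hD : 0 < D)
    (htail : ∀ᶠ t : ℝ in atTop, μ {x | t < X x} ≤ ENNReal.ofReal (D * (1 / ψ (A * t))))
    {ε : ℝ} (hε : 0 < ε) (hεA : 2 * ε * C₀ ≤ A) :
    ∫⁻ x, ENNReal.ofReal (ψ (ε * X x)) ∂μ < ∞ := by
  -- The `Δ¹` inequality at the argument `At/C₀`.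
  have hΔ' : ∀ᶠ t : ℝ in atTop, A / C₀ * t * ψ (A / C₀ * t) ≤ ψ (A * t) := by
    filter_upwards [(tendsto_id.const_mul_atTop (show 0 < A / C₀ by positivity)).eventually hΔ]
      with t ht
    have e : C₀ * (A / C₀ * id t) = A * t := by simp only [id]; field_simp
    rwa [e] at ht
  obtain ⟨T, hT⟩ := eventually_atTop.1 (htail.and hΔ')
  -- The dyadic levels start beyond the threshold where both asymptotic estimates hold; below it the
  -- integrand is bounded and the measure finite.
  obtain ⟨n₀, hn₀⟩ := pow_unbounded_of_one_lt T one_lt_two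
  set t : ℕ → ℝ := fun n => 2 ^ (n₀ + n) with ht
  have ht0 : ∀ n, 0 < t n := fun n => by positivity
  have htT : ∀ n, T ≤ t n := fun n => hn₀.le.trans (by
    simp only [ht]; exact pow_le_pow_right₀ one_le_two (by omega))
  have htn : ∀ n, (2 : ℝ) ^ n ≤ t n := fun n => pow_le_pow_right₀ one_le_two (by omega)
  have hpt : ∀ x, ENNReal.ofReal (ψ (ε * X x)) ≤ ENNReal.ofReal (ψ (ε * t 0)) +
      ∑' n : ℕ, ENNReal.ofReal (ψ (ε * (2 * t n))) * {x | t n < X x}.indicator 1 x := by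
    intro x
    rcases le_or_gt (X x) (t 0) with h | h
    · refine le_trans (ENNReal.ofReal_le_ofReal ?_) le_self_add
      have := hX0 x
      exact hψ.mono (by positivity) (by gcongr)
    · obtain ⟨n, hn1, hn2⟩ : ∃ n, t n < X x ∧ X x ≤ 2 * t n := by
        classical
        have hex : ∃ n, X x ≤ t n := by
          obtain ⟨n, hn⟩ := pow_unbounded_of_one_lt (X x) one_lt_two
          exact ⟨n, hn.le.trans (htn n)⟩
        rcases hf : Nat.find hex with _ | m
        · have := Nat.find_spec hex
          rw [hf] at this
          linarith
        · refine ⟨m, not_le.1 (Nat.find_min hex (m := m) (by omega)), ?_⟩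
          have := Nat.find_spec hex
          rw [hf] at this
          refine this.trans (le_of_eq ?_)
          simp only [ht, ← add_assoc, pow_succ]
          ring
      refine le_trans ?_ (le_add_left (ENNReal.le_tsum n))
      rw [indicator_of_mem (show x ∈ {x | t n < X x} from hn1), Pi.one_apply, mul_one]
      have := hX0 x
      exact ENNReal.ofReal_le_ofReal (hψ.mono (by positivity) (by gcongr))
  have hms : ∀ n, MeasurableSet {x | t n < X x} := fun n => measurableSet_lt measurable_const hX
  refine (lintegral_mono hpt).trans_lt ?_
  rw [lintegral_add_left measurable_const, lintegral_const,
    lintegral_tsum fun n => ((measurable_one.indicator (hms n)).const_mul _).aemeasurable]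
  refine ENNReal.add_lt_top.2 ⟨ENNReal.mul_lt_top ENNReal.ofReal_lt_top (measure_lt_top _ _), ?_⟩
  have hterm : ∀ n, ∫⁻ x, ENNReal.ofReal (ψ (ε * (2 * t n))) * {x | t n < X x}.indicator 1 x ∂μ ≤
      ENNReal.ofReal (D * C₀ / A) * 2⁻¹ ^ n := by
    intro n
    obtain ⟨h1, h2⟩ := hT (t n) (htT n)
    have htn0 := ht0 n
    rw [lintegral_const_mul _ (measurable_one.indicator (hms n)), lintegral_indicator_one (hms n)]
    have e2 : (2⁻¹ : ℝ≥0∞) ^ n = ENNReal.ofReal (2⁻¹ ^ n) := by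
      rw [ENNReal.ofReal_pow (by positivity), ENNReal.ofReal_inv_of_pos two_pos]; simp
    refine (mul_le_mul_right h1 _).trans ?_
    rw [e2, ← ENNReal.ofReal_mul (hψ.nonneg _ (by positivity)), ← ENNReal.ofReal_mul (by positivity)]
    refine ENNReal.ofReal_le_ofReal ?_
    have hψA : 0 < ψ (A * t n) := hψ.pos (by positivity)
    have h3 : ψ (ε * (2 * t n)) ≤ ψ (A / C₀ * t n) := by
      refine hψ.mono (by positivity) ?_
      rw [div_mul_eq_mul_div, le_div_iff₀ hC₀]
      nlinarith
    have h4 : ψ (A / C₀ * t n) / ψ (A * t n) ≤ C₀ / A * 2⁻¹ ^ n := by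
      rw [div_le_iff₀ hψA]
      have h5 : ψ (A / C₀ * t n) ≤ C₀ / A * (t n)⁻¹ * ψ (A * t n) := by
        calc _ = C₀ / A * (t n)⁻¹ * (A / C₀ * t n * ψ (A / C₀ * t n)) := by field_simp
          _ ≤ _ := by gcongr
      refine h5.trans ?_
      gcongr
      rw [inv_pow]
      exact inv_anti₀ (by positivity) (htn n)
    calc _ = D * (ψ (ε * (2 * t n)) / ψ (A * t n)) := by ring
      _ ≤ D * (ψ (A / C₀ * t n) / ψ (A * t n)) := by gcongr
      _ ≤ D * (C₀ / A * 2⁻¹ ^ n) := by gcongr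
      _ = _ := by ring
  refine (ENNReal.tsum_le_tsum hterm).trans_lt ?_
  rw [ENNReal.tsum_mul_left, ENNReal.tsum_geometric_two]
  exact ENNReal.mul_lt_top ENNReal.ofReal_lt_top (by simp)

variable {N : ℕ} [NeZero N]

/-! ### The Hardy-Orlicz modular is controlled by boundary values -/

-- On each slice, `ψ(|g|/D)` at radius `r` is bounded by its Poisson average over the circle of
-- radius `R`. Integration over the sphere removes the rotations.
omit [NeZero N] in
theorem modular_dilate_mono {ψ : ℝ → ℝ} (hψ : IsOrlicz ψ) {g : Cn N → ℂ}
    (hg : DifferentiableOn ℂ g (unitBall N)) {D r R : ℝ} (hD : 0 < D) (hr : 0 < r) (hrR : r < R)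
    (hR : R < 1) :
    modular ψ (vMeasure N (-1)) (fun ζ => g (r • ζ)) D ≤
      modular ψ (vMeasure N (-1)) (fun ζ => g (R • ζ)) D := by
  have hR0 : 0 < R := hr.trans hrR
  obtain ⟨ν, hν, hJ⟩ := exists_poisson_jensen hψ (R := R) (w := (r : ℂ)) (by
    rw [mem_ball_zero_iff, Complex.norm_real, Real.norm_of_nonneg hr.le]; exact hrR)
  have hGm := measurable_indicator_modular hψ hg.continuousOn hD
    (show MeasurableSet (unitBall N) from Metric.isOpen_ball.measurableSet) Subset.rfl
  set G := (unitBall N).indicator (fun z => ENNReal.ofReal (ψ (‖g z‖ / D))) with hG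
  have hGR : Measurable fun ζ : Cn N => G (R • ζ) := hGm.comp (by fun_prop)
  set e : ℝ → ℂ := fun θ => Complex.exp (θ * Complex.I) with he
  have he1 : ∀ θ, ‖e θ‖ = 1 := Complex.norm_exp_ofReal_mul_I
  rw [vMeasure_neg_one, modular, modular, lintegral_smul_measure, lintegral_smul_measure]
  refine mul_le_mul_right ?_ _
  calc _ ≤ ∫⁻ ζ, ∫⁻ θ, G (R • e θ • ζ) ∂ν ∂surfaceMeasure N := by
        refine lintegral_mono_ae ?_
        filter_upwards [ae_norm_eq_one N] with ζ hζ
        have hmem : ∀ c ∈ Metric.closedBall (0 : ℂ) R, c • ζ ∈ unitBall N := fun c hc =>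
          complex_smul_mem_unitBall hζ.le ((mem_closedBall_zero_iff.1 hc).trans_lt hR)
        have hd : DiffContOnCl ℂ (fun c : ℂ => g (c • ζ)) (Metric.ball 0 R) := by
          refine DifferentiableOn.diffContOnCl ?_
          rw [closure_ball _ hR0.ne']
          have := differentiableOn_slice hg 0 ζ (S := Metric.closedBall 0 R) fun c hc => by
            rw [zero_add]; exact hmem c hc
          simpa only [zero_add] using this
        have h1 := hJ _ hd D hD
        rw [Complex.coe_smul] at h1
        refine h1.trans (le_of_eq (lintegral_congr fun θ => ?_))
        have e1 : R • e θ • ζ = circleMap 0 R θ • ζ := by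
          rw [circleMap_zero, mul_smul, Complex.coe_smul]
        rw [e1, hG, indicator_of_mem (hmem _ (circleMap_mem_closedBall 0 hR0.le θ))]
    _ = ∫⁻ θ, ∫⁻ ζ, G (R • e θ • ζ) ∂surfaceMeasure N ∂ν :=
        lintegral_lintegral_swap (hGm.comp (by fun_prop)).aemeasurable
    _ = ∫⁻ ζ, G (R • ζ) ∂surfaceMeasure N := by
        simp only [lintegral_surfaceMeasure_rotate hGR (he1 _)]
        simp
    _ ≤ _ := lintegral_mono fun ζ => indicator_le_self _ _ _

omit [NeZero N] in
theorem measurable_modular_dilate {ψ : ℝ → ℝ} (hψ : IsOrlicz ψ) {g : Cn N → ℂ}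
    (hg : ContinuousOn g (unitBall N)) {D r : ℝ} (hD : 0 < D) (hr : r ∈ Ioo (0 : ℝ) 1) :
    AEMeasurable (fun ζ => ENNReal.ofReal (ψ (‖g (r • ζ)‖ / D))) (vMeasure N (-1)) :=
  hψ.aemeasurable_comp ((aestronglyMeasurable_of_continuousOn_closedBall
    (continuousOn_dilate hg hr)).norm.aemeasurable.div_const D) fun _ => by positivity

/-- The modular increases with the radius, and boundedness of `g` justifies dominated convergence to
the radial limits. Without some such control the boundary modular need not bound the interior ones.
-/
theorem modular_dilate_le_of_bounded {ψ : ℝ → ℝ} (hψ : IsOrlicz ψ) {g : Cn N → ℂ}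
    (hg : DifferentiableOn ℂ g (unitBall N)) {M : ℝ} (hM : ∀ z ∈ unitBall N, ‖g z‖ ≤ M)
    {Y : Cn N → ℝ} (hY : ∀ᵐ ζ ∂vMeasure N (-1), ∃ w, HasValue (-1) g ζ w ∧ ‖w‖ ≤ Y ζ) {D r : ℝ}
    (hD : 0 < D) (hr : r ∈ Ioo (0 : ℝ) 1) :
    modular ψ (vMeasure N (-1)) (fun ζ => g (r • ζ)) D ≤ modular ψ (vMeasure N (-1)) Y D := by
  have := isProbabilityMeasure_vMeasure (N := N) (le_refl (-1 : ℝ))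
  set F : ℕ → Cn N → ℝ≥0∞ := fun n ζ => ENNReal.ofReal (ψ (‖g (radius n • ζ)‖ / D)) with hF
  have hlim : ∀ ζ w, HasValue (-1) g ζ w →
      Tendsto (fun n => F n ζ) atTop (𝓝 (ENNReal.ofReal (ψ (‖w‖ / D)))) := fun ζ w hw => by
    refine ENNReal.tendsto_ofReal ?_
    have hc : Continuous fun v : ℂ => ψ (‖v‖ / D) :=
      hψ.continuous_comp (by fun_prop) fun v => by positivity
    exact (hc.tendsto w).comp ((hasValue_neg_one.1 hw).comp tendsto_radius)
  -- The `limsup` serves as the limit function, which avoids choosing a boundary value at each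
  -- point.
  have hdom := tendsto_lintegral_of_dominated_convergence' (μ := vMeasure N (-1)) (F := F)
    (f := fun ζ => limsup (fun n => F n ζ) atTop) (fun _ => ENNReal.ofReal (ψ (M / D)))
    (fun n => measurable_modular_dilate hψ hg.continuousOn hD (radius_mem n))
    (fun n => by
      filter_upwards [ae_vMeasure_norm_le_one (-1)] with ζ hζ
      refine ENNReal.ofReal_le_ofReal (hψ.mono (by positivity) ?_)
      gcongr
      exact hM _ (smul_mem_unitBall hζ (radius_mem n))) (by simp)
    (by
      filter_upwards [hY] with ζ ⟨w, hw, _⟩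
      rw [(hlim ζ w hw).limsup_eq]
      exact hlim ζ w hw)
  refine (ge_of_tendsto hdom ?_).trans (lintegral_mono_ae ?_)
  · filter_upwards [tendsto_radius.eventually (Ioo_mem_nhdsLT hr.2)] with n hn
    exact modular_dilate_mono hψ hg hD hr.1 hn.1 hn.2
  · filter_upwards [hY] with ζ ⟨w, hw, hwY⟩
    rw [(hlim ζ w hw).limsup_eq]
    refine ENNReal.ofReal_le_ofReal (hψ.mono (by positivity) ?_)
    gcongr
    exact hwY.trans (le_abs_self _)

/-! ### Sufficiency -/

/-- The growth function `ψ⁻¹(1 / (1 - |b|)^p)`. -/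
noncomputable def growth {N : ℕ} (ψ : ℝ → ℝ) (p : ℝ) (b : Cn N → Cn N) (z : Cn N) : ℝ :=
  orliczInv ψ (max (1 / (1 - ‖b z‖) ^ p) 0)

omit [NeZero N] in
theorem measurable_growth {ψ : ℝ → ℝ} (hψ : IsOrlicz ψ) (p : ℝ) {b : Cn N → Cn N}
    (hb : Measurable b) : Measurable (growth ψ p b) :=
  hψ.measurable_inv_max.comp (by fun_prop)

omit [NeZero N] in
theorem growth_nonneg {ψ : ℝ → ℝ} (hψ : IsOrlicz ψ) (p : ℝ) (b : Cn N → Cn N) (z : Cn N) :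
    0 ≤ growth ψ p b z := hψ.inv_nonneg (le_max_right _ _)

omit [NeZero N] in
theorem inv_le_growth {ψ : ℝ → ℝ} (hψ : IsOrlicz ψ) {p : ℝ} (hp : 0 < p) {b : Cn N → Cn N}
    {z : Cn N} (hb : ‖b z‖ < 1) {s : ℝ} (hs : s ≤ ‖b z‖) :
    orliczInv ψ (1 / (1 - s) ^ p) ≤ growth ψ p b z := by
  have h1 : 0 < 1 - ‖b z‖ := by linarith
  have h2 : 0 < 1 - s := by linarith
  refine hψ.inv_mono (by positivity) (le_max_of_le_left ?_)
  gcongr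

-- With `h = ψ(t)^(-1/p)`, `growth > t` forces `1-|b z| < h`, and `decay` at `h` becomes `1/ψ(At)`.
-- Points with `|b z| = 1` have growth `0` by the convention on division by zero, hence the separate
-- alternative; it is used to show that they form a null set.
omit [NeZero N] in
theorem tail_of_pullback_le {α : ℝ} {ψ : ℝ → ℝ} (hψ : IsOrlicz ψ)
    (hp : 0 < (N : ℝ) + α + 1) {φ b : Cn N → Cn N}
    (hb : ∀ᵐ z ∂vMeasure N α, HasValue α φ z (b z) ∧ ‖b z‖ ≤ 1 ∧ (α ≠ -1 → ‖b z‖ < 1))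
    {A D η : ℝ} (hη : 0 < η)
    (hpull : ∀ h ∈ Ioo (0 : ℝ) η,
      pullback N α φ (corona N α h) ≤ ENNReal.ofReal (D * decay N α ψ A h)) :
    ∀ᶠ t : ℝ in atTop, vMeasure N α {z | t < growth ψ ((N : ℝ) + α + 1) b z ∨ 1 ≤ ‖b z‖} ≤
      ENNReal.ofReal (D * (1 / ψ (A * t))) := by
  set p := (N : ℝ) + α + 1 with hpdef
  filter_upwards [eventually_gt_atTop 0, hψ.tendsto_atTop.eventually_gt_atTop (1 / η ^ p)]
    with t ht0 htη
  have hψt : 0 < ψ t := hψ.pos ht0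
  set h := (ψ t)⁻¹ ^ p⁻¹ with hh
  have hh0 : 0 < h := by positivity
  have hhp : h ^ p = (ψ t)⁻¹ := Real.rpow_inv_rpow (by positivity) hp.ne'
  have hhη : h < η := by
    rw [← Real.rpow_lt_rpow_iff hh0.le hη.le hp, hhp]
    rw [one_div] at htη
    exact inv_lt_of_inv_lt₀ (by positivity) htη
  have hdec : decay N α ψ A h = 1 / ψ (A * t) := by
    rw [decay, ← hpdef, hhp, one_div (ψ t)⁻¹, inv_inv, hψ.inv_map ht0.le]
  rw [← hdec]
  refine le_trans (measure_mono_ae ?_) (hpull h ⟨hh0, hhη⟩)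
  filter_upwards [hb] with z hz hzt
  refine ⟨b z, mem_corona_iff.2 ⟨hz.2.1, hz.2.2, ?_⟩, hz.1⟩
  rcases hzt with hzt | hzt
  · rw [growth, hψ.lt_inv_iff ht0.le (le_max_right _ _), lt_max_iff] at hzt
    rcases hzt with hzt | hzt
    · rcases hz.2.1.eq_or_lt with h1 | h1
      · rw [h1, sub_self]; exact hh0
      · have h2 : 0 < 1 - ‖b z‖ := by linarith
        rw [← Real.rpow_lt_rpow_iff h2.le hh0.le hp, hhp]
        rw [one_div] at hzt
        exact lt_inv_of_lt_inv₀ hψt hzt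
    · linarith
  · linarith

/-- For `α ≠ -1` the pointwise growth bound is enough. In the Hardy case `f ∘ φ` need not be
bounded, so `f(ρφ)` with `ρ < 1` is used: it is bounded, with boundary values `f(ρφ*)` below the
same majorant. Fatou's lemma then lets `ρ → 1` at fixed `r`. -/
theorem memSpace_comp {α : ℝ} {ψ : ℝ → ℝ} (hψ : IsOrlicz ψ)
    {φ b : Cn N → Cn N} (hφ : DifferentiableOn ℂ φ (unitBall N))
    (hmaps : MapsTo φ (unitBall N) (unitBall N)) (hp : 0 < (N : ℝ) + α + 1)
    (hb : ∀ᵐ z ∂vMeasure N α, HasValue α φ z (b z) ∧ ‖b z‖ < 1) {f : Cn N → ℂ}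
    (hf : DifferentiableOn ℂ f (unitBall N)) {L : ℝ} (hL : 0 < L)
    (hfL : ∀ a ∈ unitBall N, ‖f a‖ ≤ L * orliczInv ψ (1 / (1 - ‖a‖) ^ ((N : ℝ) + α + 1)))
    {K : ℝ} (hK : 0 < K)
    (hmod : modular ψ (vMeasure N α) (fun z => L * growth ψ ((N : ℝ) + α + 1) b z) K < ∞) :
    MemSpace N α ψ (f ∘ φ) := by
  obtain ⟨D, hKD, hD1⟩ := exists_modular_le_one hψ hK hmod
  have hD0 : 0 < D := hK.trans_le hKD
  refine ⟨hf.comp hφ hmaps, (spaceNorm_le_of_unitModular hD0 ?_).trans_lt ENNReal.ofReal_lt_top⟩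
  have hbound : ∀ z, ‖b z‖ < 1 → ∀ ρ ∈ Ioc (0 : ℝ) 1,
      ‖f (ρ • b z)‖ ≤ L * growth ψ ((N : ℝ) + α + 1) b z := by
    intro z hz ρ hρ
    have hn : ‖ρ • b z‖ ≤ ‖b z‖ := by
      rw [norm_smul, Real.norm_of_nonneg hρ.1.le]
      exact mul_le_of_le_one_left (norm_nonneg _) hρ.2
    refine (hfL _ (mem_ball_zero_iff.2 (hn.trans_lt hz))).trans ?_
    gcongr
    exact inv_le_growth hψ hp hz hn
  unfold UnitModular
  split_ifs with hα
  · subst hα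
    intro r hr
    have hmapρ : ∀ ρ ∈ Ioo (0 : ℝ) 1, MapsTo (fun z => ρ • φ z) (unitBall N) (unitBall N) :=
      fun ρ hρ z hz => smul_mem_unitBall (mem_ball_zero_iff.1 (hmaps hz)).le hρ
    have hgρ : ∀ ρ ∈ Ioo (0 : ℝ) 1,
        DifferentiableOn ℂ (fun z => f (ρ • φ z)) (unitBall N) := fun ρ hρ =>
      hf.comp (hφ.const_smul ρ) (hmapρ ρ hρ)
    have hstep : ∀ n, modular ψ (vMeasure N (-1)) (fun ζ => f (radius n • φ (r • ζ))) D ≤ 1 := by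
      intro n
      have hρ := radius_mem n
      obtain ⟨M, hM⟩ := (isCompact_closedBall (0 : Cn N) 1).exists_bound_of_continuousOn
        (continuousOn_dilate hf.continuousOn hρ)
      refine (modular_dilate_le_of_bounded hψ (hgρ _ hρ) (M := M)
        (fun z hz => hM _ (Metric.ball_subset_closedBall (hmaps hz))) ?_ hD0 hr).trans hD1
      filter_upwards [hb] with z ⟨hz1, hz2⟩
      refine ⟨f (radius n • b z), ?_, hbound z hz2 _ ⟨hρ.1, hρ.2.le⟩⟩
      have hcont : ContinuousAt (fun w => f (radius n • w)) (b z) :=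
        (continuousOn_dilate hf.continuousOn hρ).continuousAt
          (Metric.closedBall_mem_nhds_of_mem (mem_ball_zero_iff.2 hz2))
      exact hz1.comp hcont
    calc modular ψ (vMeasure N (-1)) (fun ζ => (f ∘ φ) (r • ζ)) D
        ≤ ∫⁻ ζ, liminf (fun n => ENNReal.ofReal (ψ (‖f (radius n • φ (r • ζ))‖ / D))) atTop
            ∂vMeasure N (-1) := by
          refine lintegral_mono_ae ?_
          filter_upwards [ae_vMeasure_norm_le_one (-1)] with ζ hζ
          have hφζ := hmaps (smul_mem_unitBall hζ hr)
          have h2 : Tendsto (fun n => ENNReal.ofReal (ψ (‖f (radius n • φ (r • ζ))‖ / D))) atTop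
              (𝓝 (ENNReal.ofReal (ψ (‖f ((1 : ℝ) • φ (r • ζ))‖ / D)))) := by
            refine ENNReal.tendsto_ofReal ?_
            have hc : Continuous fun v : ℂ => ψ (‖v‖ / D) :=
              hψ.continuous_comp (by fun_prop) fun v => by positivity
            refine (hc.tendsto _).comp ?_
            have hfc : ContinuousAt f ((1 : ℝ) • φ (r • ζ)) := by
              rw [one_smul]
              exact hf.continuousOn.continuousAt (Metric.isOpen_ball.mem_nhds hφζ)
            exact hfc.tendsto.comp ((tendsto_radius.mono_right nhdsWithin_le_nhds).smul_const _)
          rw [h2.liminf_eq, one_smul, Function.comp_apply]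
      _ ≤ liminf (fun n => modular ψ (vMeasure N (-1))
            (fun ζ => f (radius n • φ (r • ζ))) D) atTop :=
          lintegral_liminf_le' fun n => measurable_modular_dilate hψ
            (hgρ _ (radius_mem n)).continuousOn hD0 hr
      _ ≤ 1 := liminf_le_of_le (by isBoundedDefault) fun c hc => by
          obtain ⟨n, hn⟩ := hc.exists
          exact hn.trans (hstep n)
  · refine (modular_mono_ae hψ hD0 ?_).trans hD1
    filter_upwards [hb] with z ⟨hz1, hz2⟩
    have h1 := hbound z hz2 1 ⟨one_pos, le_rfl⟩
    rw [one_smul, ← (hasValue_of_ne hα).1 hz1] at h1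
    exact h1.trans (le_abs_self _)

/-- Under the `Δ¹`-condition, decay of the pull-back measure at the scales `A ∈ S` gives order
boundedness, with a majorant whose modular is finite at all constants controlled by `S`. -/
theorem exists_majorant {α : ℝ} (hα : -1 ≤ α) {ψ : ℝ → ℝ} (hψ : IsOrlicz ψ) (hΔ : DeltaUpOne ψ)
    {φ : Cn N → Cn N} (hφ : DifferentiableOn ℂ φ (unitBall N))
    (hmaps : MapsTo φ (unitBall N) (unitBall N)) {S : Set ℝ} (hS : ∃ A ∈ S, 0 < A)
    (hpull : ∀ A ∈ S, 0 < A → ∃ C : ℝ, 0 < C ∧ ∃ η ∈ Ioo (0 : ℝ) 1, ∀ h ∈ Ioo (0 : ℝ) η,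
      pullback N α φ (corona N α h) ≤ ENNReal.ofReal (C * decay N α ψ A h)) :
    ∃ (y : Cn N → ℝ) (κ : ℝ), 0 < κ ∧ AEStronglyMeasurable y (vMeasure N α) ∧
      (∀ A ∈ S, 0 < A → ∀ C, κ / A ≤ C → modular ψ (vMeasure N α) y C < ∞) ∧
      OrderBoundedInto N α ψ φ (fun u => u = y) := by
  have hprob := isProbabilityMeasure_vMeasure (N := N) hα
  obtain ⟨C₀, hC₀, hΔ⟩ := hΔ
  have hN1 : (1 : ℝ) ≤ N := by exact_mod_cast NeZero.one_le
  have hp : 0 < (N : ℝ) + α + 1 := by linarith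
  obtain ⟨b, hbm, hb⟩ := exists_boundary_map (α := α) hφ hmaps
  obtain ⟨C, hC1, hC⟩ := exists_norm_point_le N hα
  set p := (N : ℝ) + α + 1 with hpdef
  have hgm := measurable_growth hψ p hbm
  have htail : ∀ A ∈ S, 0 < A → ∃ D : ℝ, 0 < D ∧ ∀ᶠ t : ℝ in atTop,
      vMeasure N α {z | t < growth ψ p b z ∨ 1 ≤ ‖b z‖} ≤
        ENNReal.ofReal (D * (1 / ψ (A * t))) := fun A hA hA0 => by
    obtain ⟨D, hD, η, hη, h⟩ := hpull A hA hA0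
    exact ⟨D, hD, tail_of_pullback_le hψ hp hb hη.1 h⟩
  -- The tail bound tends to `0` as `t → ∞`, so `|φ*| < 1` almost everywhere and `f(φ*)` makes
  -- sense.
  have hb1 : ∀ᵐ z ∂vMeasure N α, HasValue α φ z (b z) ∧ ‖b z‖ < 1 := by
    obtain ⟨A, hA, hA0⟩ := hS
    obtain ⟨D, hD, hDt⟩ := htail A hA hA0
    have hlim : Tendsto (fun t : ℝ => ENNReal.ofReal (D * (1 / ψ (A * t)))) atTop (𝓝 0) := by
      rw [← ENNReal.ofReal_zero]
      refine ENNReal.tendsto_ofReal ?_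
      have h1 : Tendsto (fun t : ℝ => ψ (A * t)) atTop atTop :=
        hψ.tendsto_atTop.comp (tendsto_id.const_mul_atTop hA0)
      have h2 := (tendsto_const_nhds (x := (1 : ℝ))).div_atTop h1
      simpa using h2.const_mul D
    have hnull : vMeasure N α {z | 1 ≤ ‖b z‖} = 0 := by
      refine le_antisymm (ge_of_tendsto hlim (hDt.mono fun t ht => ?_)) zero_le
      exact (measure_mono fun z hz => Or.inr hz).trans ht
    have hnull' : ∀ᵐ z ∂vMeasure N α, ¬ 1 ≤ ‖b z‖ := by
      rw [ae_iff]
      simpa using hnull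
    filter_upwards [hb, hnull'] with z hz hz1 using ⟨hz.1, not_le.1 hz1⟩
  have hfin : ∀ L > 0, ∀ A ∈ S, 0 < A → ∀ K, 2 * L * C₀ / A ≤ K →
      modular ψ (vMeasure N α) (fun z => L * growth ψ p b z) K < ∞ := by
    intro L hL A hA hA0 K hK
    have hK0 : 0 < K := lt_of_lt_of_le (by positivity) hK
    obtain ⟨D, hD, hDt⟩ := htail A hA hA0
    have h := lintegral_lt_top_of_deltaUpOne hψ hC₀ hΔ hgm (growth_nonneg hψ p b) hA0 hD
      (hDt.mono fun t ht => (measure_mono fun z hz => Or.inl hz).trans ht) (ε := L / K)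
      (by positivity) (by
        rw [div_le_iff₀ hA0] at hK
        rw [← mul_div_assoc, div_mul_eq_mul_div, div_le_iff₀ hK0]
        linarith)
    refine lt_of_le_of_lt (le_of_eq (lintegral_congr fun z => ?_)) h
    have := growth_nonneg hψ p b z
    rw [Real.norm_of_nonneg (by positivity)]
    congr 2
    ring
  have hCp : 0 < C := by linarith
  -- Norm at most `1` yields modular at most `1` at every constant above `1`; the constant `2` is
  -- used, whence `2C`. The number `κ` is the threshold of `hfin` for `L = 2C`.
  refine ⟨fun z => 2 * C * growth ψ p b z, 2 * (2 * C) * C₀, by positivity,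
    (hgm.const_mul _).aestronglyMeasurable,
    fun A hA hA0 K hK => hfin (2 * C) (by positivity) A hA hA0 K hK, ?_, _, rfl, ?_, ?_⟩
  · intro f hf
    obtain ⟨A, hA, hA0⟩ := hS
    set K := (spaceNorm N α ψ f).toReal + 1 with hK
    have hK0 : 0 < K := by positivity
    have hmod : UnitModular N α ψ f K := unitModular_of_spaceNorm_lt hψ (by
      rw [ENNReal.lt_ofReal_iff_toReal_lt hf.2.ne]
      linarith)
    have hCK : 0 < C * K := by positivity
    exact memSpace_comp hψ hφ hmaps hp hb1 hf.1 hCK (hC ψ hψ f K hf.1 hK0 hmod)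
      (K := 2 * (C * K) * C₀ / A) (by positivity) (hfin _ hCK A hA hA0 _ le_rfl)
  · exact Eventually.of_forall fun z => mul_nonneg (by positivity) (growth_nonneg hψ p b z)
  · intro f hf hf1
    have hmod : UnitModular N α ψ f 2 := unitModular_of_spaceNorm_lt hψ
      (hf1.trans_lt (by simp))
    filter_upwards [hb1] with z ⟨hz1, hz2⟩
    have hzB : b z ∈ unitBall N := mem_ball_zero_iff.2 hz2
    refine ⟨f (b z), hz1.comp (hf.1.continuousOn.continuousAt (Metric.isOpen_ball.mem_nhds hzB)), ?_⟩
    refine (hC ψ hψ f 2 hf.1 two_pos hmod _ hzB).trans ?_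
    rw [mul_comm C 2]
    gcongr
    exact inv_le_growth hψ hp hz2 le_rfl

end BergmanOrlicz


/-! ### The four implications -/

theorem mainTheorem6 (N : ℕ) (hN : 1 ≤ N) (α : ℝ) (hα : -1 ≤ α) (ψ : ℝ → ℝ) (hψ : IsOrlicz ψ)
    (φ : Cn N → Cn N) (hφ : DifferentiableOn ℂ φ (unitBall N))
    (hmaps : MapsTo φ (unitBall N) (unitBall N)) :
    -- necessary condition for order boundedness into `L^ψ_α`
    (OrderBoundedInto N α ψ φ (MemOrlicz ψ (vMeasure N α)) →
      ∃ A : ℝ, 0 < A ∧ ∃ η ∈ Ioo (0 : ℝ) 1, ∀ h ∈ Ioo (0 : ℝ) η,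
        pullback N α φ (corona N α h) ≤ ENNReal.ofReal (decay N α ψ A h)) ∧
    -- its sufficiency under `Δ¹`
    (DeltaUpOne ψ →
      (∃ A : ℝ, 0 < A ∧ ∃ η ∈ Ioo (0 : ℝ) 1, ∀ h ∈ Ioo (0 : ℝ) η,
        pullback N α φ (corona N α h) ≤ ENNReal.ofReal (decay N α ψ A h)) →
      OrderBoundedInto N α ψ φ (MemOrlicz ψ (vMeasure N α))) ∧
    -- necessary condition for order boundedness into `M^ψ_α`
    (OrderBoundedInto N α ψ φ (MemMorseTransue ψ (vMeasure N α)) →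
      ∀ A : ℝ, 0 < A → ∃ C : ℝ, 0 < C ∧ ∃ hA ∈ Ioo (0 : ℝ) 1, ∀ h ∈ Ioo (0 : ℝ) hA,
        pullback N α φ (corona N α h) ≤ ENNReal.ofReal (C * decay N α ψ A h)) ∧
    -- its sufficiency under `Δ¹`
    (DeltaUpOne ψ →
      (∀ A : ℝ, 0 < A → ∃ C : ℝ, 0 < C ∧ ∃ hA ∈ Ioo (0 : ℝ) 1, ∀ h ∈ Ioo (0 : ℝ) hA,
        pullback N α φ (corona N α h) ≤ ENNReal.ofReal (C * decay N α ψ A h)) →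
      OrderBoundedInto N α ψ φ (MemMorseTransue ψ (vMeasure N α))) := by
  have : NeZero N := ⟨by omega⟩
  have hhalf : (1 / 2 : ℝ) ∈ Ioo (0 : ℝ) 1 := by norm_num
  have hsub : ∀ h ∈ Ioo (0 : ℝ) (1 / 2), h ∈ Ioo (0 : ℝ) 1 := fun h hh => ⟨hh.1, by linarith [hh.2]⟩
  refine ⟨?_, ?_, ?_, ?_⟩
  · rintro ⟨-, y, ⟨hym, K, hK, hfin⟩, -, hy⟩
    obtain ⟨c, hc, hpull⟩ := exists_pullback_corona_le hα hψ hym hy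
    obtain ⟨D, hKD, hD1⟩ := exists_modular_le_one hψ hK hfin
    have hD0 : 0 < D := hK.trans_le hKD
    -- With `A = c/D` the modular of `y` is taken at `D`, where it is at most `1`, so no constant
    -- remains in front of `decay`.
    refine ⟨c / D, by positivity, 1 / 2, hhalf, fun h hh => ?_⟩
    refine (hpull (c / D) (by positivity) h (hsub h hh)).trans ?_
    rw [div_div_cancel₀ hc.ne']
    exact mul_le_of_le_one_left zero_le hD1
  · rintro hΔ ⟨A, hA, η, hη, hpull⟩
    obtain ⟨y, κ, hκ, hym, hmod, hmem, u, rfl, hu0, hu⟩ := exists_majorant hα hψ hΔ hφ hmaps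
      (S := {A}) ⟨A, rfl, hA⟩ (by
        rintro _ rfl -
        exact ⟨1, one_pos, η, hη, by simpa only [one_mul] using hpull⟩)
    exact ⟨hmem, u, ⟨hym, κ / A, by positivity, hmod A rfl hA _ le_rfl⟩, hu0, hu⟩
  · rintro ⟨-, y, ⟨hym, hfin⟩, -, hy⟩ A hA
    obtain ⟨c, hc, hpull⟩ := exists_pullback_corona_le hα hψ hym hy
    have hfinA := hfin (c / A) (by positivity)
    refine ⟨(modular ψ (vMeasure N α) y (c / A)).toReal + 1, by positivity, 1 / 2, hhalf,
      fun h hh => (hpull A hA h (hsub h hh)).trans ?_⟩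
    rw [ENNReal.ofReal_mul (by positivity)]
    gcongr
    rw [ENNReal.le_ofReal_iff_toReal_le hfinA.ne (by positivity)]
    linarith
  · intro hΔ hpull
    obtain ⟨y, κ, hκ, hym, hmod, hmem, u, rfl, hu0, hu⟩ := exists_majorant hα hψ hΔ hφ hmaps
      (S := univ) ⟨1, mem_univ _, one_pos⟩ (fun A _ hA => hpull A hA)
    refine ⟨hmem, u, ⟨hym, fun C hC => ?_⟩, hu0, hu⟩
    -- Since every scale is available, `A = κ/C` reaches any prescribed constant `C`; this is what
    -- separates `M^ψ` from `L^ψ`.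
    refine hmod (κ / C) (mem_univ _) (by positivity) C ?_
    rw [div_div_cancel₀ hκ.ne']
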